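/- Let $d\ge 1$ and let $\mathscr S'=\mathscr S'(\mathbb R^d)$ be the space of tempered distributions, with Fourier transform normalised by $\mathscr F f(\xi)=\int_{\mathbb R^d} f(x)e^{-ix\cdot\xi}\,dx$. Let $\sigma:\mathbb R^d\to\mathbb R$ be a $C^\infty$ function vanishing outside $[-3/4,3/4]^d$ with $\sum_{k\in\mathbb Z^d}\sigma(\xi-k)=1$ for all $\xi\in\mathbb R^d$. For $j\in\mathbb Z$ and $k\in\mathbb Z^d$ put $\Box_{j,k}=\mathscr F^{-1}\sigma(2^{-j}\cdot-k)\mathscr F$. For $1\le p,q\le\infty$ let $M^{[j]}_{p,q}$ be the space of $f\in\mathscr S'$ with $$\|f\|_{M^{[j]}_{p,q}}:=\big\|\,\|\Box_{j,k}f\|_{L^p}\big\|_{\ell^q_k(\mathbb Z^d)}<\infty .$$ For $\mu\in\mathbb R$ let $\mathscr M^{\mu}_{p,q}$ be the space of those $f\in\mathscr S'$ that can be written as $f=\sum_{j\le 0}f_j$ (convergence in $\mathscr S'$) with $f_j\in M^{[j]}_{p,q}$ and $\sum_{j\le0}2^{j\mu}\|f_j\|_{M^{[j]}_{p,q}}<\infty$,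 normed by $$\|f\|_{\mathscr M^\mu_{p,q}}:=\inf\sum_{j\le0}2^{j\mu}\|f_j\|_{M^{[j]}_{p,q}},$$ the infimum being over all such decompositions of $f$. For $1\le r\le\infty$ let $\mathscr F L^r$ be the space of $f\in\mathscr S'$ with $\mathscr F f\in L^r$, normed by $\|f\|_{\mathscr FL^r}=\|\mathscr Ff\|_{L^r}$. Write $1/p+1/p'=1$, $1/r+1/r'=1$, and $$a(p,q)=d\Big(\frac1p+\frac1q-1\Big),\qquad \sigma(p,q)=\min\Big\{0,\ d\Big(\frac1q-\frac1p\Big),\ a(p,q)\Big\}.$$ **Proposition.** Let $1\le p,q,r\le\infty$ and let $\mu\in\mathbb R$ satisfy $\sigma(p,q)\le\mu\le a(p,q)$, where $\sigma(p,q)<a(p,q)$. Then $\mathscr M^{\mu}_{p,q}$ embeds continuously into $\mathscr FL^r$ (that is, $\mathscr M^\mu_{p,q}\subseteq\mathscr FL^r$ and there is a constant $C$ with $\|f\|_{\mathscr FL^r}\le C\|f\|_{\mathscr M^\mu_{p,q}}$ for all $f\in\mathscr M^\mu_{p,q}$) if and only if $$p\le 2,\qquad q\le r\le p',\qquad \mu-\frac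 dp\le-\frac d{r'} .$$ -/

import Mathlib

open MeasureTheory SchwartzMap Filter
open scoped ENNReal NNReal Topology FourierTransform

noncomputable section

namespace ScalingLimitModulation

/-- The Euclidean space `ℝ^d`. -/
abbrev Rd (d : ℕ) : Type := EuclideanSpace ℝ (Fin d)

variable {d : ℕ}

/-! ### The Fourier transform in the normalisation `∫ f(x) e^{-i x·ξ} dx` -/

/-- The dilation `x ↦ c • x` of `ℝ^d`, for `c ≠ 0`, as a linear homeomorphism. -/
def dilation (d : ℕ) (c : ℝ) (hc : c ≠ 0) : Rd d ≃L[ℝ] Rd d :=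
  ContinuousLinearEquiv.smulLeft (Units.mk0 c hc)

/-- The Fourier transform `φ ↦ ∫ φ(x) e^{-i x·ξ} dx` on Schwartz functions. Mathlib's `𝓕` has
`e^{-2π i x·ξ}` in place of `e^{-i x·ξ}`, hence the dilation; see `fourierS_apply`. -/
def fourierS (d : ℕ) : 𝓢(Rd d, ℂ) →L[ℂ] 𝓢(Rd d, ℂ) :=
  (compCLMOfContinuousLinearEquiv ℂ
      (dilation d (2 * Real.pi)⁻¹ (inv_ne_zero Real.two_pi_pos.ne'))) ∘L
    (FourierTransform.fourierCLM ℂ 𝓢(Rd d, ℂ))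

/-- The inverse of `fourierS`, that is `φ ↦ (2π)^{-d} ∫ φ(ξ) e^{i x·ξ} dξ`. -/
def fourierInvS (d : ℕ) : 𝓢(Rd d, ℂ) →L[ℂ] 𝓢(Rd d, ℂ) :=
  (FourierTransform.fourierInvCLM ℂ 𝓢(Rd d, ℂ)) ∘L
    (compCLMOfContinuousLinearEquiv ℂ (dilation d (2 * Real.pi) Real.two_pi_pos.ne'))

/-- The Fourier transform on tempered distributions, `⟨𝓕 u, φ⟩ = ⟨u, 𝓕 φ⟩`. -/
def fourierT (u : 𝓢'(Rd d, ℂ)) : 𝓢'(Rd d, ℂ) :=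
  PointwiseConvergenceCLM.precomp ℂ (fourierS d) u

/-- The inverse Fourier transform on tempered distributions, `⟨𝓕⁻¹ u, φ⟩ = ⟨u, 𝓕⁻¹ φ⟩`. -/
def fourierInvT (u : 𝓢'(Rd d, ℂ)) : 𝓢'(Rd d, ℂ) :=
  PointwiseConvergenceCLM.precomp ℂ (fourierInvS d) u

/-- The explicit formula for `fourierS`. -/
theorem fourierS_apply (φ : 𝓢(Rd d, ℂ)) (ξ : Rd d) :
    fourierS d φ ξ = ∫ x, Complex.exp (-(Complex.I * (inner ℝ x ξ : ℝ))) * φ x := by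
  have h : fourierS d φ ξ = 𝓕 (φ : Rd d → ℂ) ((2 * Real.pi)⁻¹ • ξ) := rfl
  rw [h, Real.fourier_eq']
  refine integral_congr_ae (Eventually.of_forall fun x => ?_)
  have h2 : (-2 * Real.pi * inner ℝ x ((2 * Real.pi)⁻¹ • ξ) : ℝ) = -(inner ℝ x ξ : ℝ) := by
    rw [real_inner_smul_right]
    field_simp
  simp only [h2, smul_eq_mul]
  congr 2
  push_cast
  ring

theorem fourierInvS_fourierS (φ : 𝓢(Rd d, ℂ)) : fourierInvS d (fourierS d φ) = φ := by
  have h : (compCLMOfContinuousLinearEquiv ℂ (dilation d (2 * Real.pi) Real.two_pi_pos.ne'))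
      (fourierS d φ) = 𝓕 φ := by
    ext x
    change 𝓕 φ ((2 * Real.pi)⁻¹ • ((2 * Real.pi) • x)) = 𝓕 φ x
    rw [inv_smul_smul₀ Real.two_pi_pos.ne']
  change 𝓕⁻ ((compCLMOfContinuousLinearEquiv ℂ (dilation d (2 * Real.pi) Real.two_pi_pos.ne'))
      (fourierS d φ)) = φ
  rw [h]
  exact FourierTransform.fourierInv_fourier_eq φ

/-! ### Lebesgue and Fourier–Lebesgue norms of tempered distributions -/

/-- The `L^p` norm of a tempered distribution `u`: it is `‖g‖_p` if `u` is (integration against) a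
function `g ∈ L^p`, and `∞` if there is no such `g`. -/
def lpNormT (p : ℝ≥0∞) [Fact (1 ≤ p)] (u : 𝓢'(Rd d, ℂ)) : ℝ≥0∞ :=
  ⨅ (g : Lp ℂ p (volume : Measure (Rd d))) (_ : Lp.toTemperedDistribution g = u), ‖g‖ₑ

theorem lpNormT_coe (p : ℝ≥0∞) [Fact (1 ≤ p)] (g : Lp ℂ p (volume : Measure (Rd d))) :
    lpNormT p (Lp.toTemperedDistribution g) = ‖g‖ₑ := by
  refine le_antisymm (iInf_le_of_le g (iInf_le_of_le rfl le_rfl)) (le_iInf₂ fun g' h => ?_)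
  have hinj := LinearMap.ker_eq_bot.mp
    (Lp.ker_toTemperedDistributionCLM_eq_bot (F := ℂ) (μ := (volume : Measure (Rd d))) (p := p))
  have : g' = g := hinj h
  rw [this]

/-- The norm `‖𝓕 u‖_r` of the Fourier–Lebesgue space `𝓕 L^r`. -/
def fourierLebesgueNorm (r : ℝ≥0∞) [Fact (1 ≤ r)] (u : 𝓢'(Rd d, ℂ)) : ℝ≥0∞ :=
  lpNormT r (fourierT u)

/-- The Fourier–Lebesgue space `𝓕 L^r`: the tempered distributions whose Fourier transform is a
function in `L^r`. -/
def fourierLebesgueSpace (d : ℕ) (r : ℝ≥0∞) [Fact (1 ≤ r)] : Set 𝓢'(Rd d, ℂ) :=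
  {u | fourierLebesgueNorm r u < ∞}

/-! ### Uniform frequency decompositions -/

/-- An integer vector `k ∈ ℤ^d` as a point of `ℝ^d`. -/
def latticePoint (k : Fin d → ℤ) : Rd d := WithLp.toLp 2 fun i => (k i : ℝ)

/-- `σ` is a smooth function, zero outside the cube `[-3/4, 3/4]^d`, whose integer translates form
a partition of unity. -/
structure IsUnitCubeCutoff (σ : Rd d → ℝ) : Prop where
  smooth : ContDiff ℝ (⊤ : ℕ∞) σ
  eq_zero : ∀ ξ : Rd d, (∃ i, 3 / 4 < |ξ i|) → σ ξ = 0
  partition : ∀ ξ : Rd d, HasSum (fun k : Fin d → ℤ => σ (ξ - latticePoint k)) 1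

/-- `σ_{j,k}(ξ) = σ(2^{-j} ξ - k)`. -/
def cutoffAt (σ : Rd d → ℝ) (j : ℤ) (k : Fin d → ℤ) (ξ : Rd d) : ℂ :=
  (σ ((2 : ℝ) ^ (-j) • ξ - latticePoint k) : ℂ)

/-- The functions `σ_{j,k}` are of temperate growth, so that multiplication of tempered
distributions by them is the genuine one. -/
theorem IsUnitCubeCutoff.hasTemperateGrowth {σ : Rd d → ℝ} (hσ : IsUnitCubeCutoff σ)
    (j : ℤ) (k : Fin d → ℤ) : (cutoffAt σ j k).HasTemperateGrowth := by
  have hcpt : HasCompactSupport σ := by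
    refine HasCompactSupport.intro
      (((isCompact_univ_pi fun _ : Fin d => isCompact_Icc (a := (-(3 / 4) : ℝ)) (b := 3 / 4)).image
        (PiLp.continuous_toLp 2 (fun _ : Fin d => ℝ)))) fun ξ hξ => hσ.eq_zero ξ ?_
    by_contra! hcon
    exact hξ ⟨ξ.ofLp, fun i _ => abs_le.mp (hcon i), rfl⟩
  have h1 : σ.HasTemperateGrowth := hcpt.hasTemperateGrowth hσ.smooth
  have h2 : (fun ξ : Rd d => (2 : ℝ) ^ (-j) • ξ - latticePoint k).HasTemperateGrowth := by
    fun_prop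
  unfold cutoffAt
  fun_prop

/-- The frequency-uniform projection `□_{j,k} u = 𝓕⁻¹ (σ_{j,k} 𝓕 u)`. -/
def box (σ : Rd d → ℝ) (j : ℤ) (k : Fin d → ℤ) (u : 𝓢'(Rd d, ℂ)) : 𝓢'(Rd d, ℂ) :=
  fourierInvT (TemperedDistribution.smulLeftCLM ℂ (cutoffAt σ j k) (fourierT u))

/-- The `ℓ^q` norm of a family in `[0, ∞]`, for `1 ≤ q ≤ ∞`. -/
def ellNorm {ι : Type*} (q : ℝ≥0∞) (a : ι → ℝ≥0∞) : ℝ≥0∞ :=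
  if q = ∞ then ⨆ i, a i else (∑' i, a i ^ q.toReal) ^ (1 / q.toReal)

/-- The norm `‖ ‖□_{j,k} u‖_{L^p} ‖_{ℓ^q_k}` of `M_{p,q}^{[j]}`. -/
def modulationNorm (σ : Rd d → ℝ) (j : ℤ) (p q : ℝ≥0∞) [Fact (1 ≤ p)] (u : 𝓢'(Rd d, ℂ)) : ℝ≥0∞ :=
  ellNorm q fun k : Fin d → ℤ => lpNormT p (box σ j k u)

/-- The space `M_{p,q}^{[j]}` of tempered distributions. -/
def modulationSpace (σ : Rd d → ℝ) (j : ℤ) (p q : ℝ≥0∞) [Fact (1 ≤ p)] : Set 𝓢'(Rd d, ℂ) :=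
  {u | modulationNorm σ j p q u < ∞}

/-! ### Scaling limits of modulation spaces -/

/-- `u = ∑_{j ≤ 0} f_j` in `𝓢'` with `f_j ∈ M_{p,q}^{[j]}`; here `f n` stands for `f_j` with
`j = -n`. -/
structure IsDecomposition (σ : Rd d → ℝ) (p q : ℝ≥0∞) [Fact (1 ≤ p)] (u : 𝓢'(Rd d, ℂ))
    (f : ℕ → 𝓢'(Rd d, ℂ)) : Prop where
  mem : ∀ n : ℕ, f n ∈ modulationSpace σ (-(n : ℤ)) p q
  tendsto : Tendsto (fun N : ℕ => ∑ n ∈ Finset.range N, f n) atTop (𝓝 u)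

/-- `∑_{j ≤ 0} 2^{jμ} ‖f_j‖_{M_{p,q}^{[j]}}`, where `f n` stands for `f_j` with `j = -n`. -/
def decompositionCost (σ : Rd d → ℝ) (p q : ℝ≥0∞) [Fact (1 ≤ p)] (μ : ℝ)
    (f : ℕ → 𝓢'(Rd d, ℂ)) : ℝ≥0∞ :=
  ∑' n : ℕ, ENNReal.ofReal ((2 : ℝ) ^ (-(n : ℝ) * μ)) * modulationNorm σ (-(n : ℤ)) p q (f n)

/-- The space `𝓜_{p,q}^μ`. -/
def scalingLimitSpace (σ : Rd d → ℝ) (p q : ℝ≥0∞) [Fact (1 ≤ p)] (μ : ℝ) : Set 𝓢'(Rd d, ℂ) :=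
  {u | ∃ f, IsDecomposition σ p q u f ∧ decompositionCost σ p q μ f < ∞}

/-- The norm of `𝓜_{p,q}^μ`: the infimum of the cost over all decompositions. -/
def scalingLimitNorm (σ : Rd d → ℝ) (p q : ℝ≥0∞) [Fact (1 ≤ p)] (μ : ℝ)
    (u : 𝓢'(Rd d, ℂ)) : ℝ≥0∞ :=
  ⨅ (f : ℕ → 𝓢'(Rd d, ℂ)) (_ : IsDecomposition σ p q u f), decompositionCost σ p q μ f

/-- The continuous embedding `𝓜_{p,q}^μ ↪ 𝓕 L^r`: inclusion, with a bound on the norms. -/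
def EmbedsInFourierLebesgue (σ : Rd d → ℝ) (p q r : ℝ≥0∞) [Fact (1 ≤ p)] [Fact (1 ≤ r)]
    (μ : ℝ) : Prop :=
  scalingLimitSpace σ p q μ ⊆ fourierLebesgueSpace d r ∧
    ∃ C : ℝ≥0, ∀ u ∈ scalingLimitSpace σ p q μ,
      fourierLebesgueNorm r u ≤ C * scalingLimitNorm σ p q μ u

/-! ### The indices -/

/-- `a(p,q) = d(1/p + 1/q - 1)`. -/
def indexA (d : ℕ) (p q : ℝ≥0∞) : ℝ := d * (p⁻¹.toReal + q⁻¹.toReal - 1)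

/-- `σ(p,q) = min(0, d(1/q - 1/p), a(p,q))`. -/
def indexSigma (d : ℕ) (p q : ℝ≥0∞) : ℝ :=
  min 0 (min (d * (q⁻¹.toReal - p⁻¹.toReal)) (indexA d p q))

end ScalingLimitModulation

end

/-! Since `1/r' = 1 - 1/r`, the last condition reads `μ ≤ d(1/r - 1/p')`; the factor `2^{jd(1/r -
1/p')}` is what Hölder costs on a frequency cube of side comparable to `2^j`.

Sufficiency. Each `𝓕 □_{j,k} f` lives on such a cube. For `p ≤ 2`, Hausdorff–Young puts it in
`L^{p'}`, and for `r ≤ p'` Hölder on the cube puts it in `L^r`. The cubes of one scale overlap at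
most `2^d` times, so the pieces glue to a bound of `‖𝓕 f‖_r` by `2^{jd(1/r - 1/p')}` times the
`M_{p,r}^{[j]}` norm (`exists_fourierT_single_scale`). For `q ≤ r` one has `ℓ^q ⊆ ℓ^r`, and for `j ≤
0` the condition on `μ` makes the factor at most `2^{jμ}`. The transforms of any decomposition of
finite cost then converge absolutely in `L^r` (`fourierLebesgueNorm_le_cost`).

Necessity. A function whose spectrum sits in the central parts of finitely many cubes of one scale
has an explicit modulation norm, because there each cutoff is exactly `0` or `1`. The embedding thus
becomes an inequality between Schwartz functions (`EmbedsInFourierLebesgue.test`), and each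
condition has its own test family: bumps of width `2^{-m}` seen at scale `2^{-n}`, `n ≤ m`, give `r
≤ p'` (`n = 0`) and the bound on `μ` (`n = m`); sums of translated bumps give `q ≤ r`; chirps, whose
modulus is fixed while their inverse transforms spread out, give `p ≤ 2`.

Hausdorff–Young itself is proved with some constant, by Marcinkiewicz interpolation between the
`L¹`–`L^∞` bound and Plancherel. -/

noncomputable section

/-! ### The Hausdorff–Young inequality -/

namespace HausdorffYoung

set_option linter.unusedSectionVars false

variable {V : Type*} [NormedAddCommGroup V] [InnerProductSpace ℝ V] [FiniteDimensional ℝ V]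
  [MeasurableSpace V] [BorelSpace V]

theorem integrable_schwartz_mul {p : ℝ≥0∞} (hp : 1 ≤ p) {g : V → ℂ} (hg : MemLp g p volume)
    (φ : 𝓢(V, ℂ)) : Integrable (fun x => φ x * g x) := by
  have := ENNReal.HolderConjugate.inv_one_sub_inv' hp
  have h := φ.memLp (1 - p⁻¹)⁻¹ volume
  have : ENNReal.HolderConjugate (1 - p⁻¹)⁻¹ p := this.symm
  exact h.integrable_mul hg

/-- `h` is the Fourier transform of `g` in the sense of tempered distributions. -/
structure IsFourierPair (g h : V → ℂ) : Prop where
  locallyIntegrable : LocallyIntegrable h volume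
  integrable_left : ∀ φ : 𝓢(V, ℂ), Integrable (fun x => 𝓕 φ x * g x)
  integrable_right : ∀ φ : 𝓢(V, ℂ), Integrable (fun x => φ x * h x)
  integral_eq : ∀ φ : 𝓢(V, ℂ), ∫ x, 𝓕 φ x * g x = ∫ x, φ x * h x

theorem isFourierPair_of_memLp {p q : ℝ≥0∞} (hp : 1 ≤ p) (hq : 1 ≤ q) {g h : V → ℂ}
    (hg : MemLp g p volume) (hh : MemLp h q volume)
    (heq : ∀ φ : 𝓢(V, ℂ), ∫ x, 𝓕 φ x * g x = ∫ x, φ x * h x) : IsFourierPair g h :=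
  ⟨hh.locallyIntegrable hq, fun _ => integrable_schwartz_mul hp hg _,
    fun _ => integrable_schwartz_mul hq hh _, heq⟩

theorem IsFourierPair.add {g₁ h₁ g₂ h₂ : V → ℂ} (H₁ : IsFourierPair g₁ h₁)
    (H₂ : IsFourierPair g₂ h₂) : IsFourierPair (g₁ + g₂) (h₁ + h₂) where
  locallyIntegrable := H₁.1.add H₂.1
  integrable_left φ := by
    simpa only [Pi.add_apply, mul_add] using! (H₁.integrable_left φ).add (H₂.integrable_left φ)
  integrable_right φ := by
    simpa only [Pi.add_apply, mul_add] using! (H₁.integrable_right φ).add (H₂.integrable_right φ)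
  integral_eq φ := by
    simp only [Pi.add_apply, mul_add]
    rw [integral_add (H₁.integrable_left φ) (H₂.integrable_left φ),
      integral_add (H₁.integrable_right φ) (H₂.integrable_right φ), H₁.integral_eq, H₂.integral_eq]

theorem IsFourierPair.const_mul {g h : V → ℂ} (H : IsFourierPair g h) (c : ℂ) :
    IsFourierPair (fun x => c * g x) (fun x => c * h x) where
  locallyIntegrable := H.1.smul c
  integrable_left φ := by simpa [mul_left_comm] using (H.integrable_left φ).const_mul c
  integrable_right φ := by simpa [mul_left_comm] using (H.integrable_right φ).const_mul c
  integral_eq φ := by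
    simp only [mul_left_comm _ c]
    rw [integral_const_mul, integral_const_mul, H.integral_eq]

theorem IsFourierPair.congr_left {g g' h : V → ℂ} (H : IsFourierPair g h)
    (hg : g =ᵐ[volume] g') : IsFourierPair g' h where
  locallyIntegrable := H.1
  integrable_left φ := (H.integrable_left φ).congr (by filter_upwards [hg] with x hx; rw [hx])
  integrable_right := H.integrable_right
  integral_eq φ := by
    rw [← H.integral_eq]
    exact integral_congr_ae (by filter_upwards [hg] with x hx; rw [hx])

theorem ae_eq_of_schwartz {h h' : V → ℂ} (hh : LocallyIntegrable h volume)
    (hh' : LocallyIntegrable h' volume)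
    (H : ∀ φ : 𝓢(V, ℂ), HasCompactSupport φ → ∫ x, φ x * h x = ∫ x, φ x * h' x) :
    h =ᵐ[volume] h' := by
  refine ae_eq_of_integral_contDiff_smul_eq hh hh' fun g hg hgc => ?_
  have h₁ : HasCompactSupport (Complex.ofRealCLM ∘ g) := hgc.comp_left rfl
  have h₂ : ContDiff ℝ (⊤ : ℕ∞) (Complex.ofRealCLM ∘ g) := by fun_prop
  simpa using H (h₁.toSchwartzMap h₂) h₁

/-- The interpolation below splits `g` differently at each height; uniqueness shows that all these
splittings produce the same transform. -/
theorem IsFourierPair.unique {g h h' : V → ℂ} (H : IsFourierPair g h)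
    (H' : IsFourierPair g h') : h =ᵐ[volume] h' :=
  ae_eq_of_schwartz H.1 H'.1 fun φ _ => by rw [← H.integral_eq, H'.integral_eq]

/-! ### The endpoints `L¹ → L^∞` and `L² → L²` -/

theorem enorm_fourier_le (g : V → ℂ) (ξ : V) : ‖𝓕 g ξ‖ₑ ≤ eLpNorm g 1 volume := by
  rw [Real.fourier_eq, eLpNorm_one_eq_lintegral_enorm]
  refine (enorm_integral_le_lintegral_enorm _).trans (lintegral_mono fun x => ?_)
  rw [Circle.smul_def, enorm_smul, ← ofReal_norm, Circle.norm_coe]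
  simp

theorem isFourierPair_L1 {g : V → ℂ} (hg : Integrable g) : IsFourierPair g (𝓕 g) := by
  have hc : Continuous (𝓕 g) :=
    VectorFourier.fourierIntegral_continuous Real.continuous_fourierChar
      (by exact continuous_inner) hg
  refine isFourierPair_of_memLp le_rfl le_top (memLp_one_iff_integrable.mpr hg)
    (q := ∞) ⟨hc.aestronglyMeasurable, ?_⟩ fun φ => ?_
  · rw [eLpNorm_exponent_top]
    refine lt_of_le_of_lt (eLpNormEssSup_le_of_ae_enorm_bound (C := eLpNorm g 1 volume)
      (Eventually.of_forall fun x => enorm_fourier_le g x)) ?_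
    exact (memLp_one_iff_integrable.mpr hg).2
  · have := VectorFourier.integral_bilin_fourierIntegral_eq_flip (ContinuousLinearMap.mul ℂ ℂ)
      (L := innerₗ V) Real.continuous_fourierChar (by exact continuous_inner) (φ.integrable (μ := volume)) hg
    rw [flip_innerₗ] at this
    exact this

theorem exists_isFourierPair_L2 {g : V → ℂ} (hg : MemLp g 2 volume) :
    ∃ h : V → ℂ, IsFourierPair g h ∧ eLpNorm h 2 volume = eLpNorm g 2 volume := by
  have : Fact ((1 : ℝ≥0∞) ≤ 2) := ⟨by norm_num⟩
  set G : Lp ℂ 2 (volume : Measure V) := hg.toLp g with hG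
  set H : Lp ℂ 2 (volume : Measure V) := 𝓕 G with hH
  refine ⟨H, isFourierPair_of_memLp (p := 2) (q := 2) (by norm_num) (by norm_num) hg
    (Lp.memLp _) fun φ => ?_, ?_⟩
  · have h := congrArg (fun u : 𝓢'(V, ℂ) => u φ) (Lp.fourier_toTemperedDistribution_eq G)
    simp only [TemperedDistribution.fourier_apply, Lp.toTemperedDistribution_apply,
      smul_eq_mul] at h
    rw [← h]
    exact integral_congr_ae (by filter_upwards [hg.coeFn_toLp] with x hx; rw [hx])
  · have := Lp.norm_fourier_eq G
    rw [Lp.norm_def, Lp.norm_def, ENNReal.toReal_eq_toReal_iff' (Lp.eLpNorm_ne_top _)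
      (Lp.eLpNorm_ne_top _)] at this
    rw [this]
    exact eLpNorm_congr_ae hg.coeFn_toLp

/-! ### Marcinkiewicz interpolation between the endpoints -/

/-- The part of `g` at height `t` of the Marcinkiewicz decomposition: the set where `g` is
moderate. -/
def lowSet (g : V → ℂ) (p t : ℝ) : Set V := {x | t * ‖g x‖ ^ (p - 1) ≤ 2}

theorem measurableSet_lowSet {g : V → ℂ} (hg : StronglyMeasurable g) (p t : ℝ) :
    MeasurableSet (lowSet g p t) :=
  measurableSet_le ((hg.norm.measurable.pow_const _).const_mul t) measurable_const

/-- Off `lowSet`, `t |g|^{p-1} > 2`, hence `|g| ≤ (t/2) |g|^p`. The bound `t/2` is chosen so that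
the transform of this part uses up at most half of the height `t`. -/
theorem eLpNorm_high_le {g : V → ℂ} (hg : StronglyMeasurable g) {p t : ℝ} (hp : 1 < p)
    (ht : 0 < t) (h1 : ∫⁻ x, ‖g x‖ₑ ^ p = 1) :
    eLpNorm ((lowSet g p t)ᶜ.indicator g) 1 volume ≤ ENNReal.ofReal (t / 2) := by
  have key : ∀ x, ‖(lowSet g p t)ᶜ.indicator g x‖ₑ ≤ ENNReal.ofReal (t / 2) * ‖g x‖ₑ ^ p := by
    intro x
    by_cases hx : x ∈ lowSet g p t
    · simp [hx]
    · have hx' : x ∈ (lowSet g p t)ᶜ := hx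
      rw [Set.indicator_of_mem hx', ← ofReal_norm,
        ENNReal.ofReal_rpow_of_nonneg (norm_nonneg _) (by linarith),
        ← ENNReal.ofReal_mul (by positivity)]
      refine ENNReal.ofReal_le_ofReal ?_
      simp only [lowSet, Set.mem_ofPred_eq, not_le] at hx
      have h0 : 0 < ‖g x‖ := by
        rcases (norm_nonneg (g x)).eq_or_lt with h | h
        · rw [← h, Real.zero_rpow (by linarith)] at hx
          linarith
        · exact h
      have : ‖g x‖ ^ p = ‖g x‖ ^ (p - 1) * ‖g x‖ := by
        rw [← Real.rpow_add_one h0.ne']; ring_nf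
      rw [this]
      nlinarith
  rw [eLpNorm_one_eq_lintegral_enorm]
  calc _ ≤ ∫⁻ x, ENNReal.ofReal (t / 2) * ‖g x‖ₑ ^ p := lintegral_mono key
    _ = ENNReal.ofReal (t / 2) := by
      rw [lintegral_const_mul _ (by fun_prop (disch := exact hg.measurable)), h1, mul_one]

/-- On `lowSet` the function is bounded because `p > 1`, and a bounded function in `L^p` with `p <
2` is in `L²`. Only finiteness matters here; the size of the `L²` norm is kept exact until the
heights are integrated. -/
theorem memLp_low {g : V → ℂ} (hg : StronglyMeasurable g) {p t : ℝ} (hp : 1 < p) (hp2 : p < 2)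
    (ht : 0 < t) (h1 : ∫⁻ x, ‖g x‖ₑ ^ p = 1) :
    MemLp ((lowSet g p t).indicator g) 2 volume := by
  refine ⟨(hg.indicator (measurableSet_lowSet hg p t)).aestronglyMeasurable, ?_⟩
  rw [eLpNorm_lt_top_iff_lintegral_rpow_enorm_lt_top (by norm_num) (by norm_num)]
  set M : ℝ := ((2 / t) ^ (p - 1)⁻¹) ^ (2 - p)
  have key : ∀ x, ‖(lowSet g p t).indicator g x‖ₑ ^ (2 : ℝ≥0∞).toReal
      ≤ ENNReal.ofReal M * ‖g x‖ₑ ^ p := by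
    intro x
    by_cases hx : x ∈ lowSet g p t
    · rw [Set.indicator_of_mem hx, ← ofReal_norm, ENNReal.ofReal_rpow_of_nonneg (norm_nonneg _)
        (by simp), ENNReal.ofReal_rpow_of_nonneg (norm_nonneg _) (by linarith),
        ← ENNReal.ofReal_mul (by positivity)]
      refine ENNReal.ofReal_le_ofReal ?_
      rcases (norm_nonneg (g x)).eq_or_lt with h | h
      · rw [← h]
        simp only [ENNReal.toReal_ofNat]
        rw [Real.zero_rpow (by norm_num), Real.zero_rpow (by linarith)]
        simp
      · simp only [lowSet, Set.mem_ofPred_eq] at hx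
        have h2 : ‖g x‖ ^ (p - 1) ≤ 2 / t := by rw [le_div_iff₀ ht]; linarith
        have h3 : ‖g x‖ ≤ (2 / t) ^ (p - 1)⁻¹ := by
          rw [Real.le_rpow_inv_iff_of_pos (norm_nonneg _) (by positivity) (by linarith)]
          exact h2
        calc ‖g x‖ ^ (2 : ℝ≥0∞).toReal = ‖g x‖ ^ (2 - p) * ‖g x‖ ^ p := by
              rw [← Real.rpow_add h]; simp
          _ ≤ _ := mul_le_mul_of_nonneg_right
              (Real.rpow_le_rpow h.le h3 (by linarith)) (by positivity)
    · rw [Set.indicator_of_notMem hx]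
      simp
  refine (lintegral_mono key).trans_lt ?_
  rw [lintegral_const_mul _ (by fun_prop (disch := exact hg.measurable)), h1, mul_one]
  exact ENNReal.ofReal_lt_top

/-- The high part has a transform bounded by `t/2`, so `|h| > t` forces the transform of the low
part to be at least `t/2`; Chebyshev in `L²` and Plancherel bound the measure of that set. -/
theorem exists_isFourierPair_of_level {g : V → ℂ} (hg : StronglyMeasurable g) {p t : ℝ}
    (hp : 1 < p) (hp2 : p < 2) (ht : 0 < t) (h1 : ∫⁻ x, ‖g x‖ₑ ^ p = 1) :
    ∃ h : V → ℂ, IsFourierPair g h ∧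
      volume {x | t < ‖h x‖} ≤ ENNReal.ofReal (4 / t ^ 2) *
        ∫⁻ x, (lowSet g p t).indicator (fun x => ENNReal.ofReal (‖g x‖ ^ 2)) x := by
  obtain ⟨h₂, hpair₂, hn⟩ := exists_isFourierPair_L2 (memLp_low hg hp hp2 ht h1)
  set g₁ := (lowSet g p t)ᶜ.indicator g
  have hb := eLpNorm_high_le hg hp ht h1
  have hg₁ : Integrable g₁ := by
    rw [← memLp_one_iff_integrable]
    exact ⟨(hg.indicator (measurableSet_lowSet hg p t).compl).aestronglyMeasurable,
      hb.trans_lt ENNReal.ofReal_lt_top⟩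
  have hpair := (isFourierPair_L1 hg₁).add hpair₂
  rw [Set.indicator_compl_add_self] at hpair
  refine ⟨_, hpair, ?_⟩
  have hsub : {x | t < ‖(𝓕 g₁ + h₂) x‖} ⊆ {x | ENNReal.ofReal (t / 2) ≤ ‖h₂ x‖ₑ} := by
    intro x hx
    simp only [Set.mem_ofPred_eq, Pi.add_apply] at hx ⊢
    have h3 : ‖𝓕 g₁ x‖ ≤ t / 2 := by
      have := (enorm_fourier_le g₁ x).trans hb
      rwa [← ofReal_norm, ENNReal.ofReal_le_ofReal_iff (by positivity)] at this
    rw [← ofReal_norm]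
    refine ENNReal.ofReal_le_ofReal ?_
    linarith [norm_add_le (𝓕 g₁ x) (h₂ x)]
  refine (measure_mono hsub).trans ?_
  have hmeas : AEStronglyMeasurable h₂ volume := hpair₂.1.aestronglyMeasurable
  have hmk := meas_ge_le_mul_pow_eLpNorm_enorm volume (p := 2) (by norm_num) (by norm_num) hmeas
    (ε := ENNReal.ofReal (t / 2)) (by simpa using ht) (by simp)
  refine hmk.trans ?_
  rw [hn]
  have e1 : (ENNReal.ofReal (t / 2))⁻¹ ^ (2 : ℝ≥0∞).toReal = ENNReal.ofReal (4 / t ^ 2) := by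
    rw [← ENNReal.ofReal_inv_of_pos (by positivity), ENNReal.ofReal_rpow_of_nonneg (by positivity)
      (by simp)]
    congr 1
    simp only [ENNReal.toReal_ofNat, Real.rpow_ofNat]
    field_simp
    norm_num
  rw [e1, eLpNorm_eq_lintegral_rpow_enorm_toReal (by norm_num) (by norm_num), ← ENNReal.rpow_mul]
  simp only [ENNReal.toReal_ofNat, one_div, inv_mul_cancel₀ (two_ne_zero' ℝ), ENNReal.rpow_one]
  gcongr with x
  by_cases hx : x ∈ lowSet g p t
  · simp [hx, ← ofReal_norm, ENNReal.ofReal_pow]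
  · simp [hx]

/-- The integral runs up to `T = 2 N^{1-p}` and equals `N² T^{s-2}/(s-2)`. For the conjugate
exponent `(p-1)(s-2) = 2-p`, so exactly `N^p` remains; `p < 2` gives `s > 2`, hence convergence at
`0`. -/
theorem lintegral_power_level {N p s : ℝ} (hN : 0 ≤ N) (hp : 1 < p) (hp2 : p < 2)
    (hs : s = p / (p - 1)) :
    ∫⁻ t in Set.Ioi (0 : ℝ), {t | t * N ^ (p - 1) ≤ 2}.indicator
      (fun t => ENNReal.ofReal (N ^ 2 * t ^ (s - 3))) t ≤
      ENNReal.ofReal (2 ^ (s - 2) / (s - 2)) * ENNReal.ofReal (N ^ p) := by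
  have hs2 : 2 < s := by rw [hs, lt_div_iff₀ (by linarith)]; linarith
  rcases hN.eq_or_lt with h | h
  · rw [← h]
    simp
  set T : ℝ := 2 / N ^ (p - 1) with hT
  have hNp : 0 < N ^ (p - 1) := Real.rpow_pos_of_pos h _
  have hTpos : 0 < T := by positivity
  have hset : {t : ℝ | t * N ^ (p - 1) ≤ 2} = Set.Iic T := by
    ext t
    simp [hT, le_div_iff₀ hNp]
  rw [hset, lintegral_indicator measurableSet_Iic, Measure.restrict_restrict measurableSet_Iic,
    Set.inter_comm, Set.Ioi_inter_Iic]
  have hint : IntegrableOn (fun t : ℝ => t ^ (s - 3)) (Set.Ioc 0 T) := by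
    rw [← intervalIntegrable_iff_integrableOn_Ioc_of_le hTpos.le]
    exact intervalIntegral.intervalIntegrable_rpow' (by linarith)
  rw [← ofReal_integral_eq_lintegral_ofReal (hint.const_mul _)
    ((ae_restrict_mem measurableSet_Ioc).mono fun t ht => by
      have := ht.1; simp only [Pi.zero_apply]; positivity),
    integral_const_mul, ← intervalIntegral.integral_of_le hTpos.le,
    integral_rpow (Or.inl (by linarith)), ← ENNReal.ofReal_mul (by
      have : 0 < s - 2 := by linarith
      positivity)]
  refine ENNReal.ofReal_le_ofReal (le_of_eq ?_)
  have e : s - 3 + 1 = s - 2 := by ring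
  rw [e, Real.zero_rpow (by linarith), sub_zero, hT, Real.div_rpow (by norm_num) hNp.le,
    ← Real.rpow_mul h.le]
  have e2 : (p - 1) * (s - 2) = 2 - p := by
    rw [hs]
    have : p - 1 ≠ 0 := by linarith
    field_simp
    ring
  rw [e2]
  have e3 : N ^ 2 = N ^ p * N ^ (2 - p) := by
    rw [← Real.rpow_add h]; norm_num
  have : 0 < N ^ (2 - p) := Real.rpow_pos_of_pos h _
  rw [e3]
  field_simp

/-- The layer-cake formula turns the level estimates into a double integral; after Tonelli the inner
integral over heights is `lintegral_power_level`. -/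
theorem exists_isFourierPair_normalized {g : V → ℂ} (hg : StronglyMeasurable g) {p s : ℝ}
    (hp : 1 < p) (hp2 : p < 2) (hs : s = p / (p - 1)) (h1 : ∫⁻ x, ‖g x‖ₑ ^ p = 1) :
    ∃ h : V → ℂ, IsFourierPair g h ∧
      ∫⁻ x, ‖h x‖ₑ ^ s ≤ ENNReal.ofReal (s * 4 * (2 ^ (s - 2) / (s - 2))) := by
  have hs2 : 2 < s := by rw [hs, lt_div_iff₀ (by linarith)]; linarith
  -- The height `1` is arbitrary: it only supplies the transform `h`.
  obtain ⟨h, hpair, -⟩ := exists_isFourierPair_of_level hg hp hp2 one_pos h1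
  have hmeas := hpair.1.aestronglyMeasurable
  refine ⟨h, hpair, ?_⟩
  have hlev : ∀ t : ℝ, 0 < t → volume {x | t < ‖h x‖} ≤ ENNReal.ofReal (4 / t ^ 2) *
        ∫⁻ x, (lowSet g p t).indicator (fun x => ENNReal.ofReal (‖g x‖ ^ 2)) x := by
    intro t ht
    obtain ⟨h', hpair', hb⟩ := exists_isFourierPair_of_level hg hp hp2 ht h1
    refine le_trans (le_of_eq (measure_congr ?_)) hb
    filter_upwards [hpair.unique hpair'] with x hx
    change (t < ‖h x‖) = (t < ‖h' x‖)
    rw [hx]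
  have hF : Measurable (fun z : ℝ × V => {z : ℝ × V | z.1 * ‖g z.2‖ ^ (p - 1) ≤ 2}.indicator
      (fun z => ENNReal.ofReal (‖g z.2‖ ^ 2 * z.1 ^ (s - 3))) z) := by
    have := hg.norm.measurable
    have hm : MeasurableSet {z : ℝ × V | z.1 * ‖g z.2‖ ^ (p - 1) ≤ 2} :=
      measurableSet_le (f := fun z : ℝ × V => z.1 * ‖g z.2‖ ^ (p - 1)) (g := fun _ => (2 : ℝ))
        (by fun_prop) measurable_const
    exact Measurable.indicator (by fun_prop) hm
  have e0 : ∀ x, ‖h x‖ₑ ^ s = ENNReal.ofReal (‖h x‖ ^ s) := fun x => by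
    rw [← ofReal_norm, ENNReal.ofReal_rpow_of_nonneg (norm_nonneg _) (by linarith)]
  simp_rw [e0]
  rw [lintegral_rpow_eq_lintegral_meas_lt_mul volume (Eventually.of_forall fun x => norm_nonneg _)
    hmeas.norm.aemeasurable (by linarith)]
  calc ENNReal.ofReal s * ∫⁻ t in Set.Ioi (0 : ℝ),
          volume {a | t < ‖h a‖} * ENNReal.ofReal (t ^ (s - 1))
      ≤ ENNReal.ofReal s * ∫⁻ t in Set.Ioi (0 : ℝ), ∫⁻ x, ENNReal.ofReal 4 *
          {z : ℝ × V | z.1 * ‖g z.2‖ ^ (p - 1) ≤ 2}.indicator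
            (fun z => ENNReal.ofReal (‖g z.2‖ ^ 2 * z.1 ^ (s - 3))) (t, x) := by
        refine mul_le_mul_right ?_ _
        refine setLIntegral_mono' measurableSet_Ioi fun t ht => ?_
        have ht : 0 < t := ht
        refine (mul_le_mul_left (hlev t ht) _).trans (le_of_eq ?_)
        rw [mul_right_comm, ← ENNReal.ofReal_mul (by positivity),
          ← lintegral_const_mul' _ _ ENNReal.ofReal_ne_top]
        congr 1 with x
        by_cases hx : t * ‖g x‖ ^ (p - 1) ≤ 2
        · have hx' : x ∈ lowSet g p t := hx
          have hx'' : (t, x) ∈ {z : ℝ × V | z.1 * ‖g z.2‖ ^ (p - 1) ≤ 2} := hx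
          rw [Set.indicator_of_mem hx', Set.indicator_of_mem hx'',
            ← ENNReal.ofReal_mul (by positivity), ← ENNReal.ofReal_mul (by positivity)]
          congr 1
          have : t ^ (s - 1) = t ^ (s - 3) * t ^ 2 := by
            rw [← Real.rpow_natCast, ← Real.rpow_add ht]; norm_num; ring_nf
          rw [this]
          field_simp
        · have hx' : x ∉ lowSet g p t := hx
          have hx'' : (t, x) ∉ {z : ℝ × V | z.1 * ‖g z.2‖ ^ (p - 1) ≤ 2} := hx
          rw [Set.indicator_of_notMem hx', Set.indicator_of_notMem hx'']
          simp
    _ = ENNReal.ofReal s * (ENNReal.ofReal 4 * ∫⁻ x, ∫⁻ t in Set.Ioi (0 : ℝ),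
          {z : ℝ × V | z.1 * ‖g z.2‖ ^ (p - 1) ≤ 2}.indicator
            (fun z => ENNReal.ofReal (‖g z.2‖ ^ 2 * z.1 ^ (s - 3))) (t, x)) := by
        rw [lintegral_lintegral_swap (hF.const_mul _).aemeasurable]
        simp_rw [lintegral_const_mul' _ _ ENNReal.ofReal_ne_top]
    _ ≤ ENNReal.ofReal s * (ENNReal.ofReal 4 * ∫⁻ x,
          ENNReal.ofReal (2 ^ (s - 2) / (s - 2)) * ‖g x‖ₑ ^ p) := by
        gcongr with x
        refine (lintegral_power_level (norm_nonneg (g x)) hp hp2 hs).trans (le_of_eq ?_)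
        rw [← ofReal_norm, ENNReal.ofReal_rpow_of_nonneg (norm_nonneg _) (by linarith)]
    _ = _ := by
        rw [lintegral_const_mul' _ _ ENNReal.ofReal_ne_top, h1, mul_one,
          ← ENNReal.ofReal_mul (by norm_num), ← ENNReal.ofReal_mul (by linarith)]
        congr 1
        ring

theorem IsFourierPair.of_ae_zero {g : V → ℂ} (hg : g =ᵐ[volume] 0) : IsFourierPair g 0 := by
  have h0 : IsFourierPair (0 : V → ℂ) 0 :=
    isFourierPair_of_memLp (p := 1) (q := 1) le_rfl le_rfl MemLp.zero MemLp.zero (by simp)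
  exact h0.congr_left hg.symm

/-- The **Hausdorff–Young inequality** (with an unspecified constant). -/
theorem hausdorff_young {p : ℝ≥0∞} (hp : 1 ≤ p) (hp2 : p ≤ 2) :
    ∃ C : ℝ≥0, ∀ g : V → ℂ, MemLp g p volume → ∃ h : V → ℂ, IsFourierPair g h ∧
      eLpNorm h p.conjExponent volume ≤ C * eLpNorm g p volume := by
  rcases hp.eq_or_lt with rfl | hp1
  · refine ⟨1, fun g hg => ⟨𝓕 g, isFourierPair_L1 (memLp_one_iff_integrable.mp hg), ?_⟩⟩
    have : ENNReal.conjExponent 1 = ∞ := by simp [ENNReal.conjExponent]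
    rw [this, eLpNorm_exponent_top, ENNReal.coe_one, one_mul]
    exact eLpNormEssSup_le_of_ae_enorm_bound (Eventually.of_forall fun x => enorm_fourier_le g x)
  rcases hp2.eq_or_lt with rfl | hp2
  · refine ⟨1, fun g hg => ?_⟩
    obtain ⟨h, hpair, he⟩ := exists_isFourierPair_L2 hg
    refine ⟨h, hpair, ?_⟩
    have e : (2 : ℝ≥0∞) - 1 = 1 := by
      rw [← one_add_one_eq_two]; exact ENNReal.add_sub_cancel_right ENNReal.one_ne_top
    have : ENNReal.conjExponent 2 = 2 := by
      rw [ENNReal.conjExponent, e, inv_one, one_add_one_eq_two]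
    rw [this, he, ENNReal.coe_one, one_mul]
  have hptop : p ≠ ∞ := hp2.ne_top
  lift p to ℝ≥0 using hptop
  have hq1 : 1 < (p : ℝ) := by exact_mod_cast hp1
  have hq2 : (p : ℝ) < 2 := by exact_mod_cast hp2
  set s : ℝ := p / (p - 1) with hs
  have hspos : 0 < s := div_pos (by linarith) (by linarith)
  have hconj : ENNReal.conjExponent (p : ℝ≥0∞) = ENNReal.ofReal s := by
    have : Real.HolderConjugate p s := by
      rw [hs]; exact Real.HolderConjugate.conjExponent hq1
    have h1 : ENNReal.HolderConjugate (ENNReal.ofReal p) (ENNReal.ofReal s) :=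
      Real.HolderConjugate.ennrealOfReal this
    rw [ENNReal.ofReal_coe_nnreal] at h1
    exact h1.conjExponent_eq
  set K : ℝ := s * 4 * (2 ^ (s - 2) / (s - 2)) with hK
  refine ⟨(K ^ s⁻¹).toNNReal, fun g hg => ?_⟩
  have hp0 : (p : ℝ≥0∞) ≠ 0 := (zero_lt_one.trans hp1).ne'
  obtain ⟨g', hg', hgg'⟩ := hg.1
  rw [eLpNorm_congr_ae hgg']
  have hlp' : MemLp g' p volume := hg.ae_eq hgg'
  suffices H : ∃ h : V → ℂ, IsFourierPair g' h ∧
      eLpNorm h (ENNReal.conjExponent p) volume ≤ (K ^ s⁻¹).toNNReal * eLpNorm g' p volume by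
    obtain ⟨h, hpair, hb⟩ := H
    exact ⟨h, hpair.congr_left hgg'.symm, hb⟩
  rcases eq_or_ne (eLpNorm g' p volume) 0 with h0 | h0
  · refine ⟨0, IsFourierPair.of_ae_zero ((eLpNorm_eq_zero_iff hlp'.1 hp0).mp h0), ?_⟩
    simp
  -- The level estimate is not homogeneous in `g`, so `g` is divided by its norm and the transform
  -- multiplied back.
  set A : ℝ := (eLpNorm g' p volume).toReal with hA
  have hApos : 0 < A := ENNReal.toReal_pos h0 hlp'.2.ne
  have hAe : ENNReal.ofReal A = eLpNorm g' p volume := ENNReal.ofReal_toReal hlp'.2.ne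
  have hnorm : ∫⁻ x, ‖((A⁻¹ : ℝ) : ℂ) * g' x‖ₑ ^ (p : ℝ) = 1 := by
    have h1 : eLpNorm (fun x => ((A⁻¹ : ℝ) : ℂ) * g' x) p volume = 1 := by
      have := eLpNorm_const_smul ((A⁻¹ : ℝ) : ℂ) g' p volume
      change eLpNorm (((A⁻¹ : ℝ) : ℂ) • g') p volume = 1
      rw [this, ← hAe, ← ofReal_norm, Complex.norm_real, Real.norm_of_nonneg (by positivity),
        ← ENNReal.ofReal_mul (by positivity), inv_mul_cancel₀ hApos.ne', ENNReal.ofReal_one]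
    rw [eLpNorm_eq_lintegral_rpow_enorm_toReal hp0 ENNReal.coe_ne_top] at h1
    have h2 := congrArg (fun y : ℝ≥0∞ => y ^ (p : ℝ)) h1
    simp only [ENNReal.coe_toReal, one_div, ENNReal.one_rpow] at h2
    rwa [← ENNReal.rpow_mul, inv_mul_cancel₀ (by linarith), ENNReal.rpow_one] at h2
  obtain ⟨h, hpair, hb⟩ := exists_isFourierPair_normalized
    (hg'.const_mul ((A⁻¹ : ℝ) : ℂ)) hq1 hq2 hs hnorm
  refine ⟨fun x => (A : ℂ) * h x, ?_, ?_⟩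
  · have := hpair.const_mul (A : ℂ)
    refine this.congr_left (Eventually.of_forall fun x => ?_)
    have : (A : ℂ) ≠ 0 := by exact_mod_cast hApos.ne'
    simp [this]
  · have e := eLpNorm_const_smul (A : ℂ) h (ENNReal.ofReal s) volume
    rw [hconj]
    change eLpNorm ((A : ℂ) • h) _ volume ≤ _
    rw [e, ← ofReal_norm, Complex.norm_real, Real.norm_of_nonneg hApos.le, hAe, mul_comm]
    gcongr
    rw [eLpNorm_eq_lintegral_rpow_enorm_toReal (by simpa using hspos) ENNReal.ofReal_ne_top,
      ENNReal.toReal_ofReal hspos.le, one_div]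
    change _ ≤ ENNReal.ofReal (K ^ s⁻¹)
    have hs2 : 2 < s := by rw [hs, lt_div_iff₀ (by linarith)]; linarith
    have hKpos : 0 ≤ K := by
      have : 0 < s - 2 := by linarith
      positivity
    rw [← ENNReal.ofReal_rpow_of_nonneg hKpos (by positivity)]
    exact ENNReal.rpow_le_rpow hb (by positivity)

/-! ### Density of compactly supported functions in the Schwartz space -/

variable (V) in
/-- A smooth bump equal to `1` on the unit ball. -/
def unitBump : ContDiffBump (0 : V) where
  rIn := 1
  rOut := 2
  rIn_pos := one_pos
  rIn_lt_rOut := one_lt_two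

/-- The dilated bump `x ↦ χ(x / (n + 1))`. -/
def dilatedBump (n : ℕ) (x : V) : ℂ := ((unitBump V ((n + 1 : ℝ)⁻¹ • x) : ℝ) : ℂ)

theorem contDiff_dilatedBump (n : ℕ) : ContDiff ℝ (⊤ : ℕ∞) (dilatedBump (V := V) n) := by
  unfold dilatedBump
  exact Complex.ofRealCLM.contDiff.comp ((unitBump V).contDiff.comp (contDiff_const_smul _))

theorem hasCompactSupport_dilatedBump (n : ℕ) : HasCompactSupport (dilatedBump (V := V) n) := by
  have h1 := (unitBump V).hasCompactSupport.comp_left (g := fun r : ℝ => (r : ℂ)) (by simp)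
  exact h1.comp_smul (by positivity : (n + 1 : ℝ)⁻¹ ≠ 0)

/-- Uniform in `n` because `i` derivatives of a dilation bring out `(n+1)^{-i} ≤ 1`; the extra `1`
in the bound covers the constant when `i = 0`. -/
theorem exists_bound_dilatedBump (i : ℕ) :
    ∃ B : ℝ, 0 ≤ B ∧ ∀ (n : ℕ) (x : V), ‖iteratedFDeriv ℝ i (fun y => dilatedBump n y - 1) x‖ ≤ B := by
  have hc0 : ContDiff ℝ (⊤ : ℕ∞) (fun y : V => ((unitBump V y : ℝ) : ℂ)) :=
    Complex.ofRealCLM.contDiff.comp (unitBump V).contDiff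
  have hcs : HasCompactSupport (fun y : V => ((unitBump V y : ℝ) : ℂ)) :=
    (unitBump V).hasCompactSupport.comp_left (g := fun r : ℝ => (r : ℂ)) (by simp)
  set B := SchwartzMap.seminorm ℝ 0 i (hcs.toSchwartzMap hc0)
  refine ⟨B + 1, by positivity, fun n x => ?_⟩
  have h1 : ∀ y : V, ‖iteratedFDeriv ℝ i (fun y : V => ((unitBump V y : ℝ) : ℂ)) y‖ ≤ B :=
    fun y => norm_iteratedFDeriv_le_seminorm ℝ (hcs.toSchwartzMap hc0) i y
  have h2 : ‖iteratedFDeriv ℝ i (dilatedBump n) x‖ ≤ B := by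
    have := iteratedFDeriv_comp_const_smul (n + 1 : ℝ)⁻¹ (hc0.of_le (m := i) (by exact_mod_cast le_top))
    change ‖iteratedFDeriv ℝ i (fun x : V => ((unitBump V ((n + 1 : ℝ)⁻¹ • x) : ℝ) : ℂ)) x‖ ≤ B
    rw [this, norm_smul, norm_pow, norm_inv, Real.norm_of_nonneg (by positivity)]
    have h3 : ((n + 1 : ℝ)⁻¹) ^ i ≤ 1 :=
      pow_le_one₀ (by positivity) (inv_le_one_of_one_le₀ (by linarith [n.cast_nonneg (α := ℝ)]))
    calc _ ≤ 1 * B := mul_le_mul h3 (h1 _) (norm_nonneg _) zero_le_one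
      _ = B := one_mul B
  have hsub : iteratedFDeriv ℝ i (fun y => dilatedBump n y - 1) x
      = iteratedFDeriv ℝ i (dilatedBump n) x - iteratedFDeriv ℝ i (fun _ : V => (1 : ℂ)) x :=
    iteratedFDeriv_sub_apply ((contDiff_dilatedBump n).of_le (by exact_mod_cast le_top)).contDiffAt
      contDiff_const.contDiffAt
  rw [hsub]
  refine (norm_sub_le _ _).trans (add_le_add h2 ?_)
  rcases i with _ | i
  · simp
  · rw [iteratedFDeriv_const_of_ne (by omega)]
    simp

/-- The error `(χ_n - 1) φ` vanishes for `‖x‖ < n + 1`. Elsewhere one more power of `‖x‖` in the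
seminorm of `φ` buys a factor `1/(n+1)`, while the derivatives of `χ_n - 1` stay bounded. -/
theorem tendsto_dilatedBump_smul (φ : 𝓢(V, ℂ)) :
    Tendsto (fun n : ℕ => smulLeftCLM ℂ (dilatedBump n) φ) atTop (𝓝 φ) := by
  rw [(schwartz_withSeminorms ℝ V ℂ).tendsto_nhds]
  rintro ⟨k, m⟩ ε hε
  choose B hB0 hB using exists_bound_dilatedBump (V := V)
  set K : ℝ := ∑ i ∈ Finset.range (m + 1), (m.choose i : ℝ) * B i *
    SchwartzMap.seminorm ℝ (k + 1) (m - i) φ with hK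
  have hK0 : 0 ≤ K := Finset.sum_nonneg fun i _ =>
    mul_nonneg (mul_nonneg (by positivity) (hB0 i)) (by positivity)
  have hT : ∀ n : ℕ, (dilatedBump (V := V) n).HasTemperateGrowth := fun n =>
    (hasCompactSupport_dilatedBump n).hasTemperateGrowth (contDiff_dilatedBump n)
  have hbound : ∀ n : ℕ, SchwartzMap.seminorm ℝ k m (smulLeftCLM ℂ (dilatedBump n) φ - φ)
      ≤ K / (n + 1) := by
    intro n
    refine seminorm_le_bound ℝ k m _ (by positivity) fun x => ?_
    have hfun : (⇑(smulLeftCLM ℂ (dilatedBump n) φ - φ) : V → ℂ)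
        = fun y => (dilatedBump n y - 1) * φ y := by
      ext y
      rw [sub_apply, smulLeftCLM_apply_apply (hT n), smul_eq_mul]
      ring
    rw [hfun]
    by_cases hx : ‖x‖ < n + 1
    · have : (fun y => (dilatedBump n y - 1) * φ y) =ᶠ[𝓝 x] fun _ => (0 : ℂ) := by
        filter_upwards [(isOpen_lt continuous_norm continuous_const).mem_nhds hx] with y hy
        have hy : ‖y‖ < n + 1 := hy
        have h1 : unitBump V ((n + 1 : ℝ)⁻¹ • y) = 1 := by
          apply ContDiffBump.one_of_mem_closedBall
          rw [mem_closedBall_zero_iff, norm_smul, norm_inv, Real.norm_of_nonneg (by positivity)]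
          change _ ≤ (1 : ℝ)
          rw [inv_mul_le_iff₀ (by positivity)]
          linarith
        simp [dilatedBump, h1]
      rw [(EventuallyEq.iteratedFDeriv ℝ this m).eq_of_nhds]
      have hz : iteratedFDeriv ℝ m (fun _ : V => (0 : ℂ)) x = 0 := by
        rw [iteratedFDeriv_fun_zero]; rfl
      rw [hz, norm_zero, mul_zero]
      positivity
    · push Not at hx
      have hn1 : (0 : ℝ) < n + 1 := by positivity
      have hd := norm_iteratedFDeriv_mul_le (n := m) (N := ((⊤ : ℕ∞) : WithTop ℕ∞))
        (((contDiff_dilatedBump (V := V) n)).sub (contDiff_const (c := (1 : ℂ))))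
        (φ.smooth ⊤) x (by exact_mod_cast le_top)
      calc ‖x‖ ^ k * ‖iteratedFDeriv ℝ m (fun y => (dilatedBump n y - 1) * φ y) x‖
          ≤ ‖x‖ ^ k * ∑ i ∈ Finset.range (m + 1), (m.choose i : ℝ) *
            ‖iteratedFDeriv ℝ i (fun y => dilatedBump n y - 1) x‖ *
              ‖iteratedFDeriv ℝ (m - i) φ x‖ := by gcongr
        _ = ∑ i ∈ Finset.range (m + 1), (m.choose i : ℝ) *
            ‖iteratedFDeriv ℝ i (fun y => dilatedBump n y - 1) x‖ *
              (‖x‖ ^ k * ‖iteratedFDeriv ℝ (m - i) φ x‖) := by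
            rw [Finset.mul_sum]; congr 1 with i; ring
        _ ≤ ∑ i ∈ Finset.range (m + 1), (m.choose i : ℝ) * B i *
              (SchwartzMap.seminorm ℝ (k + 1) (m - i) φ / (n + 1)) := by
            refine Finset.sum_le_sum fun i _ => ?_
            have h1 := hB i n x
            have h2 : ‖x‖ ^ k * ‖iteratedFDeriv ℝ (m - i) φ x‖ ≤
                SchwartzMap.seminorm ℝ (k + 1) (m - i) φ / (n + 1) := by
              rw [le_div_iff₀ hn1]
              refine le_trans ?_ (le_seminorm ℝ (k + 1) (m - i) φ x)
              rw [pow_succ]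
              have : 0 ≤ ‖x‖ ^ k * ‖iteratedFDeriv ℝ (m - i) φ x‖ := by positivity
              nlinarith
            gcongr
            exact mul_nonneg (by positivity) (hB0 i)
        _ = K / (n + 1) := by
            rw [hK, Finset.sum_div]; congr 1 with i; ring
  have hlim : Tendsto (fun n : ℕ => K / ((n : ℝ) + 1)) atTop (𝓝 0) :=
    tendsto_const_div_atTop_nhds_zero_nat K |>.comp (tendsto_add_atTop_nat 1) |>.congr
      fun n => by simp
  filter_upwards [hlim.eventually_lt_const hε] with n hn
  exact (hbound n).trans_lt hn

/-- Tempered distributions are determined by their values on compactly supported functions. -/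
theorem temperedDistribution_ext_compactSupport {u v : 𝓢'(V, ℂ)}
    (h : ∀ φ : 𝓢(V, ℂ), HasCompactSupport φ → u φ = v φ) : u = v := by
  ext φ
  have hu := ((u.continuous.tendsto φ).comp (tendsto_dilatedBump_smul φ))
  have hv := ((v.continuous.tendsto φ).comp (tendsto_dilatedBump_smul φ))
  refine tendsto_nhds_unique hu (hv.congr fun n => (h _ ?_).symm)
  have hT : (dilatedBump (V := V) n).HasTemperateGrowth :=
    (hasCompactSupport_dilatedBump n).hasTemperateGrowth (contDiff_dilatedBump n)
  rw [smulLeftCLM_apply hT]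
  exact (hasCompactSupport_dilatedBump n).smul_right

/-! ### Dilations -/

/-- At `p = ∞` the exponent `p⁻¹.toReal` is `0`, so the same formula covers that case. -/
theorem eLpNorm_comp_const_smul (p : ℝ≥0∞) {f : V → ℂ} (hf : AEStronglyMeasurable f volume) {c : ℝ}
    (hc : 0 < c) : eLpNorm (fun x => f (c • x)) p volume =
      ENNReal.ofReal (c ^ (-(Module.finrank ℝ V * p⁻¹.toReal))) * eLpNorm f p volume := by
  have hmap := Measure.map_addHaar_smul (volume : Measure V) hc.ne'
  have hpos : 0 < |(c ^ Module.finrank ℝ V)⁻¹| := by positivity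
  have h0 : ENNReal.ofReal |(c ^ Module.finrank ℝ V)⁻¹| ≠ 0 :=
    (ENNReal.ofReal_pos.mpr hpos).ne'
  have hf' : AEStronglyMeasurable f (Measure.map (c • ·) (volume : Measure V)) := by
    rw [hmap]; exact hf.smul_measure _
  have h1 := eLpNorm_map_measure (p := p) hf' (measurable_const_smul c).aemeasurable
  change eLpNorm (f ∘ (c • ·)) p volume = _
  rw [← h1, hmap, eLpNorm_smul_measure_of_ne_zero h0, smul_eq_mul, one_div,
    ENNReal.ofReal_rpow_of_pos hpos]
  congr 2
  rw [abs_of_nonneg (by positivity), ← Real.rpow_natCast, ← Real.rpow_neg hc.le,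
    ← Real.rpow_mul hc.le]
  ring_nf

theorem aestronglyMeasurable_comp_const_smul {f : V → ℂ} (hf : AEStronglyMeasurable f volume)
    {c : ℝ} (hc : c ≠ 0) : AEStronglyMeasurable (fun x => f (c • x)) volume :=
  hf.comp_quasiMeasurePreserving (Measure.quasiMeasurePreserving_smul volume hc)

theorem memLp_comp_const_smul {p : ℝ≥0∞} {f : V → ℂ} (hf : MemLp f p volume) {c : ℝ}
    (hc : 0 < c) : MemLp (fun x => f (c • x)) p volume := by
  refine ⟨aestronglyMeasurable_comp_const_smul hf.1 hc.ne', ?_⟩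
  rw [eLpNorm_comp_const_smul p hf.1 hc]
  exact ENNReal.mul_lt_top ENNReal.ofReal_lt_top hf.2

end HausdorffYoung

/-! ### Fourier transforms of tempered distributions in the normalisation `e^{-i x·ξ}` -/

namespace ScalingLimitModulation

open HausdorffYoung

variable {d : ℕ}

theorem lpNormT_eq_eLpNorm {p : ℝ≥0∞} [Fact (1 ≤ p)] {u : 𝓢'(Rd d, ℂ)} {h : Rd d → ℂ}
    (hh : MemLp h p volume) (hu : ∀ φ : 𝓢(Rd d, ℂ), u φ = ∫ x, φ x * h x) :
    lpNormT p u = eLpNorm h p volume := by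
  have : u = Lp.toTemperedDistribution (hh.toLp h) := by
    ext φ
    rw [hu, Lp.toTemperedDistribution_apply]
    refine integral_congr_ae ?_
    filter_upwards [hh.coeFn_toLp] with x hx
    rw [hx, smul_eq_mul]
  rw [this, lpNormT_coe, Lp.enorm_toLp]

theorem exists_memLp_of_lpNormT_lt_top {p : ℝ≥0∞} [Fact (1 ≤ p)] {u : 𝓢'(Rd d, ℂ)}
    (hu : lpNormT p u < ∞) : ∃ h : Rd d → ℂ, MemLp h p volume ∧
      (∀ φ : 𝓢(Rd d, ℂ), u φ = ∫ x, φ x * h x) ∧ eLpNorm h p volume = lpNormT p u := by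
  have hex : ∃ g : Lp ℂ p (volume : Measure (Rd d)), Lp.toTemperedDistribution g = u := by
    by_contra! hcon
    refine hu.ne ?_
    simp [lpNormT, hcon]
  obtain ⟨g, rfl⟩ := hex
  refine ⟨g, Lp.memLp g, fun φ => by simp, ?_⟩
  rw [lpNormT_coe, Lp.enorm_def]

theorem schwartz_coe_apply (φ χ : 𝓢(Rd d, ℂ)) :
    (φ : 𝓢'(Rd d, ℂ)) χ = ∫ x, χ x * φ x :=
  toTemperedDistributionCLM_apply_apply volume φ χ

theorem lpNormT_schwartz (p : ℝ≥0∞) [Fact (1 ≤ p)] (φ : 𝓢(Rd d, ℂ)) :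
    lpNormT p (φ : 𝓢'(Rd d, ℂ)) = eLpNorm φ p volume :=
  lpNormT_eq_eLpNorm (φ.memLp p volume) (schwartz_coe_apply φ)

theorem fourierT_apply (u : 𝓢'(Rd d, ℂ)) (φ : 𝓢(Rd d, ℂ)) : fourierT u φ = u (fourierS d φ) := rfl

theorem fourierInvT_apply (u : 𝓢'(Rd d, ℂ)) (φ : 𝓢(Rd d, ℂ)) :
    fourierInvT u φ = u (fourierInvS d φ) := rfl

theorem fourierT_fourierInvT (u : 𝓢'(Rd d, ℂ)) : fourierT (fourierInvT u) = u := by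
  ext φ
  rw [fourierT_apply, fourierInvT_apply, fourierInvS_fourierS]

theorem continuous_fourierT : Continuous (fourierT (d := d)) :=
  (PointwiseConvergenceCLM.precomp ℂ (fourierS d)).continuous

theorem fourierT_sum {ι : Type*} (s : Finset ι) (u : ι → 𝓢'(Rd d, ℂ)) :
    fourierT (∑ i ∈ s, u i) = ∑ i ∈ s, fourierT (u i) :=
  map_sum (PointwiseConvergenceCLM.precomp ℂ (fourierS d)) u s

theorem fourierT_zero : fourierT (0 : 𝓢'(Rd d, ℂ)) = 0 :=
  map_zero (PointwiseConvergenceCLM.precomp ℂ (fourierS d))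

theorem fourierInvT_zero : fourierInvT (0 : 𝓢'(Rd d, ℂ)) = 0 :=
  map_zero (PointwiseConvergenceCLM.precomp ℂ (fourierInvS d))

theorem fourierS_eq (φ : 𝓢(Rd d, ℂ)) (ξ : Rd d) :
    fourierS d φ ξ = 𝓕 φ ((2 * Real.pi)⁻¹ • ξ) := rfl

/-- Hausdorff–Young for tempered distributions. -/
theorem exists_hausdorff_young_fourierT (d : ℕ) {p : ℝ≥0∞} [Fact (1 ≤ p)] (hp2 : p ≤ 2) :
    ∃ C : ℝ≥0, ∀ u : 𝓢'(Rd d, ℂ), lpNormT p u < ∞ → ∃ h : Rd d → ℂ,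
      MemLp h p.conjExponent volume ∧ (∀ φ : 𝓢(Rd d, ℂ), fourierT u φ = ∫ x, φ x * h x) ∧
      eLpNorm h p.conjExponent volume ≤ C * lpNormT p u := by
  obtain ⟨C, hC⟩ := hausdorff_young (V := Rd d) (p := p) Fact.out hp2
  have hpi : (0 : ℝ) < 2 * Real.pi := Real.two_pi_pos
  set a : ℝ := (2 * Real.pi) ^ d with ha
  set b : ℝ := (2 * Real.pi) ^ (-(Module.finrank ℝ (Rd d) * p⁻¹.toReal)) with hb
  refine ⟨C * a.toNNReal * b.toNNReal, fun u hu => ?_⟩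
  obtain ⟨g, hg, hug, hn⟩ := exists_memLp_of_lpNormT_lt_top hu
  -- The factor `a` is the Jacobian of `x ↦ 2πx`: with it, Mathlib's transform of `g'` is the
  -- transform of `g` in the present normalisation.
  set g' : Rd d → ℂ := (a : ℂ) • fun x => g ((2 * Real.pi) • x) with hg'
  have hgm : MemLp g' p volume := (memLp_comp_const_smul hg hpi).const_smul _
  have hnorm : eLpNorm g' p volume = a.toNNReal * (b.toNNReal * lpNormT p u) := by
    rw [hg', eLpNorm_const_smul, eLpNorm_comp_const_smul p hg.1 hpi, hn, ← ofReal_norm,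
      Complex.norm_real, Real.norm_of_nonneg (by positivity)]
    rfl
  obtain ⟨h, hpair, hle⟩ := hC g' hgm
  refine ⟨h, ⟨hpair.1.aestronglyMeasurable, hle.trans_lt ?_⟩, fun φ => ?_, ?_⟩
  · exact ENNReal.mul_lt_top ENNReal.coe_lt_top hgm.2
  · rw [fourierT_apply, hug, ← hpair.integral_eq]
    have := Measure.integral_comp_smul (volume : Measure (Rd d))
      (fun x => fourierS d φ x * g x) (2 * Real.pi)
    rw [finrank_euclideanSpace_fin, abs_of_nonneg (by positivity)] at this
    have h2 : ∀ x : Rd d, 𝓕 φ x * g' x =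
        (a : ℂ) * (fourierS d φ ((2 * Real.pi) • x) * g ((2 * Real.pi) • x)) := by
      intro x
      rw [fourierS_eq, inv_smul_smul₀ hpi.ne', hg']
      simp only [Pi.smul_apply, smul_eq_mul]
      ring
    simp_rw [h2]
    rw [integral_const_mul, this, Complex.real_smul, ← mul_assoc, ← Complex.ofReal_mul,
      ha, mul_inv_cancel₀ (by positivity)]
    simp
  · rw [hnorm] at hle
    refine hle.trans (le_of_eq ?_)
    push_cast
    ring

/-- The inverse Fourier transform of a Schwartz function, in terms of Mathlib's. -/
def fourierInvFun (ψ : 𝓢(Rd d, ℂ)) : Rd d → ℂ :=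
  (((2 * Real.pi) ^ d)⁻¹ : ℝ) • fun y => 𝓕⁻ ψ ((2 * Real.pi)⁻¹ • y)

theorem memLp_fourierInvFun (p : ℝ≥0∞) (ψ : 𝓢(Rd d, ℂ)) : MemLp (fourierInvFun ψ) p volume :=
  (memLp_comp_const_smul ((𝓕⁻ ψ).memLp p volume) (by positivity)).const_smul _

theorem fourierInvT_schwartz_apply (ψ φ : 𝓢(Rd d, ℂ)) :
    fourierInvT (ψ : 𝓢'(Rd d, ℂ)) φ = ∫ y, φ y * fourierInvFun ψ y := by
  have hpi : (0 : ℝ) < 2 * Real.pi := Real.two_pi_pos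
  rw [fourierInvT_apply, schwartz_coe_apply]
  simp_rw [← smul_eq_mul]
  set φ' : 𝓢(Rd d, ℂ) := compCLMOfContinuousLinearEquiv ℂ
    (dilation d (2 * Real.pi) Real.two_pi_pos.ne') φ with hφ'
  have h1 : fourierInvS d φ = 𝓕⁻ φ' := rfl
  rw [h1, integral_fourierInv_smul_eq]
  have h2 : ∀ x, φ' x • 𝓕⁻ ψ x = (fun y => φ y * 𝓕⁻ ψ ((2 * Real.pi)⁻¹ • y)) ((2 * Real.pi) • x) := by
    intro x
    simp only [inv_smul_smul₀ hpi.ne']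
    rfl
  rw [integral_congr_ae (Eventually.of_forall h2), Measure.integral_comp_smul volume
    (fun y => φ y * 𝓕⁻ ψ ((2 * Real.pi)⁻¹ • y)), finrank_euclideanSpace_fin, abs_of_nonneg (by positivity),
    ← integral_smul]
  congr 1 with y
  simp [fourierInvFun]
  ring

/-- The change of normalisation costs a factor depending only on `d` and `p`, so the test functions
can be computed with Mathlib's inverse transform. -/
theorem lpNormT_fourierInvT (p : ℝ≥0∞) [Fact (1 ≤ p)] (ψ : 𝓢(Rd d, ℂ)) :
    lpNormT p (fourierInvT (ψ : 𝓢'(Rd d, ℂ))) =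
      ENNReal.ofReal (((2 * Real.pi) ^ d)⁻¹ *
        (2 * Real.pi)⁻¹ ^ (-(Module.finrank ℝ (Rd d) * p⁻¹.toReal))) *
        eLpNorm (𝓕⁻ ψ : 𝓢(Rd d, ℂ)) p volume := by
  rw [lpNormT_eq_eLpNorm (memLp_fourierInvFun p ψ) (fourierInvT_schwartz_apply ψ), fourierInvFun,
    eLpNorm_const_smul, eLpNorm_comp_const_smul p (𝓕⁻ ψ : 𝓢(Rd d, ℂ)).continuous.aestronglyMeasurable
      (by positivity), ← ofReal_norm, Real.norm_of_nonneg (by positivity),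
    ENNReal.ofReal_mul (by positivity), mul_assoc]

/-! ### The `ℓ^q` norm -/

theorem ellNorm_mono {ι : Type*} (q : ℝ≥0∞) {a b : ι → ℝ≥0∞} (h : ∀ i, a i ≤ b i) :
    ellNorm q a ≤ ellNorm q b := by
  unfold ellNorm
  split_ifs
  · exact iSup_mono h
  · gcongr with i
    exact h i

theorem ellNorm_const_mul {ι : Type*} {q : ℝ≥0∞} (hq : 1 ≤ q) (c : ℝ≥0∞) (a : ι → ℝ≥0∞) :
    ellNorm q (fun i => c * a i) = c * ellNorm q a := by
  unfold ellNorm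
  split_ifs with h
  · rw [ENNReal.mul_iSup]
  · have hpos : 0 < q.toReal := ENNReal.toReal_pos (zero_lt_one.trans_le hq).ne' h
    simp_rw [ENNReal.mul_rpow_of_nonneg _ _ hpos.le]
    rw [ENNReal.tsum_mul_left, ENNReal.mul_rpow_of_nonneg _ _ (by positivity), ← ENNReal.rpow_mul,
      mul_one_div_cancel hpos.ne', ENNReal.rpow_one]

theorem le_ellNorm {ι : Type*} {q : ℝ≥0∞} (hq : 1 ≤ q) (a : ι → ℝ≥0∞) (i : ι) :
    a i ≤ ellNorm q a := by
  unfold ellNorm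
  split_ifs with h
  · exact le_iSup a i
  · have hpos : 0 < q.toReal := ENNReal.toReal_pos (zero_lt_one.trans_le hq).ne' h
    rw [one_div, ENNReal.le_rpow_inv_iff hpos]
    exact ENNReal.le_tsum (f := fun i => a i ^ q.toReal) i

/-- Write `a_i^r = a_i^{r-q} a_i^q` and bound the first factor by the `ℓ^q` norm, which dominates
every entry. -/
theorem ellNorm_antitone {ι : Type*} {q r : ℝ≥0∞} (hq : 1 ≤ q) (hqr : q ≤ r) (a : ι → ℝ≥0∞) :
    ellNorm r a ≤ ellNorm q a := by
  by_cases hr : r = ∞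
  · conv_lhs => rw [ellNorm, if_pos hr]
    exact iSup_le (le_ellNorm hq a)
  have hqt : q ≠ ∞ := fun h => hr (top_le_iff.mp (h ▸ hqr))
  have hpos : 0 < q.toReal := ENNReal.toReal_pos (zero_lt_one.trans_le hq).ne' hqt
  have hqr' : q.toReal ≤ r.toReal := ENNReal.toReal_mono hr hqr
  have hrpos : 0 < r.toReal := hpos.trans_le hqr'
  set A := ellNorm q a with hA
  rw [ellNorm, if_neg hr, one_div, ENNReal.rpow_inv_le_iff hrpos]
  have hAq : ∑' i, a i ^ q.toReal = A ^ q.toReal := by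
    rw [hA, ellNorm, if_neg hqt, ← ENNReal.rpow_mul, one_div_mul_cancel hpos.ne', ENNReal.rpow_one]
  have hsplit : ∀ x : ℝ≥0∞, x ^ r.toReal = x ^ (r.toReal - q.toReal) * x ^ q.toReal := fun x => by
    rw [← ENNReal.rpow_add_of_nonneg _ _ (by linarith) hpos.le]; ring_nf
  calc ∑' i, a i ^ r.toReal ≤ ∑' i, A ^ (r.toReal - q.toReal) * a i ^ q.toReal := by
        refine ENNReal.tsum_le_tsum fun i => ?_
        rw [hsplit]
        exact mul_le_mul_left (ENNReal.rpow_le_rpow (le_ellNorm hq a i) (by linarith)) _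
    _ = A ^ r.toReal := by rw [ENNReal.tsum_mul_left, hAq, ← hsplit]

/-- The `L^r` norm of a sum of functions with bounded overlap. -/
theorem eLpNorm_le_ellNorm_of_overlap {α ι : Type*} [MeasurableSpace α] {μ : Measure α}
    [Countable ι] {r : ℝ≥0∞} (hr : 1 ≤ r) {H : α → ℂ} {h : ι → α → ℂ} {M : ℕ}
    (hh : ∀ k, AEStronglyMeasurable (h k) μ)
    (hH : ∀ x, ∃ F : Finset ι, F.card ≤ M ∧ ‖H x‖ₑ ≤ ∑ k ∈ F, ‖h k x‖ₑ) :
    eLpNorm H r μ ≤ M * ellNorm r fun k => eLpNorm (h k) r μ := by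
  have hcard : ∀ (F : Finset ι) (b : ι → ℝ≥0∞) (A : ℝ≥0∞), F.card ≤ M → (∀ k, b k ≤ A) →
      ∑ k ∈ F, b k ≤ M * A := by
    intro F b A hF hb
    calc ∑ k ∈ F, b k ≤ F.card • A := Finset.sum_le_card_nsmul _ _ _ fun k _ => hb k
      _ ≤ M * A := by rw [nsmul_eq_mul]; gcongr
  by_cases hrt : r = ∞
  · subst hrt
    rw [ellNorm, if_pos rfl]
    simp_rw [eLpNorm_exponent_top]
    refine eLpNormEssSup_le_of_ae_enorm_bound ?_
    have hall : ∀ᵐ x ∂μ, ∀ k, ‖h k x‖ₑ ≤ eLpNormEssSup (h k) μ :=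
      ae_all_iff.mpr fun k => ae_le_eLpNormEssSup
    filter_upwards [hall] with x hx
    obtain ⟨F, hF, hle⟩ := hH x
    exact hle.trans (hcard F _ _ hF fun k => (hx k).trans (le_iSup (fun k => eLpNormEssSup (h k) μ) k))
  · have hr0 : r ≠ 0 := (zero_lt_one.trans_le hr).ne'
    have hpos : 0 < r.toReal := ENNReal.toReal_pos hr0 hrt
    -- At each point at most `M` terms contribute, and each is at most the `ℓ^r` norm of all the
    -- values there.
    have hpt : ∀ x, ‖H x‖ₑ ^ r.toReal ≤ (M : ℝ≥0∞) ^ r.toReal * ∑' k, ‖h k x‖ₑ ^ r.toReal := by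
      intro x
      obtain ⟨F, hF, hle⟩ := hH x
      have h1 := hle.trans (hcard F (fun k => ‖h k x‖ₑ) (ellNorm r fun k => ‖h k x‖ₑ) hF
        fun k => le_ellNorm hr _ k)
      have h2 := ENNReal.rpow_le_rpow h1 hpos.le
      rwa [ENNReal.mul_rpow_of_nonneg _ _ hpos.le, ellNorm, if_neg hrt, ← ENNReal.rpow_mul,
        one_div_mul_cancel hpos.ne', ENNReal.rpow_one] at h2
    have hk : ∀ k, eLpNorm (h k) r μ ^ r.toReal = ∫⁻ x, ‖h k x‖ₑ ^ r.toReal ∂μ := fun k => by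
      rw [eLpNorm_eq_lintegral_rpow_enorm_toReal hr0 hrt, ← ENNReal.rpow_mul,
        one_div_mul_cancel hpos.ne', ENNReal.rpow_one]
    rw [eLpNorm_eq_lintegral_rpow_enorm_toReal hr0 hrt, ellNorm, if_neg hrt]
    simp_rw [hk]
    rw [← lintegral_tsum fun k => (hh k).enorm.pow_const _]
    calc (∫⁻ x, ‖H x‖ₑ ^ r.toReal ∂μ) ^ (1 / r.toReal)
        ≤ (∫⁻ x, (M : ℝ≥0∞) ^ r.toReal * ∑' k, ‖h k x‖ₑ ^ r.toReal ∂μ) ^ (1 / r.toReal) := by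
          gcongr with x
          exact hpt x
      _ = _ := by
          rw [lintegral_const_mul' _ _ (ENNReal.rpow_ne_top_of_nonneg hpos.le (by simp)),
            ENNReal.mul_rpow_of_nonneg _ _ (by positivity), ← ENNReal.rpow_mul,
            mul_one_div_cancel hpos.ne', ENNReal.rpow_one]

/-! ### The frequency cubes -/

/-- The cube of side `3/2 · 2^j` centred at `2^j k`. -/
def freqCube (j : ℤ) (k : Fin d → ℤ) : Set (Rd d) :=
  {ξ | ∀ i, |(2 : ℝ) ^ (-j) * ξ i - k i| ≤ 3 / 4}

theorem isClosed_freqCube (j : ℤ) (k : Fin d → ℤ) : IsClosed (freqCube j k) := by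
  have : freqCube j k = ⋂ i, {ξ : Rd d | |(2 : ℝ) ^ (-j) * ξ i - k i| ≤ 3 / 4} := by
    ext ξ; simp [freqCube]
  rw [this]
  exact isClosed_iInter fun i => isClosed_le (by fun_prop) continuous_const

theorem cutoffAt_eq_zero {σ : Rd d → ℝ} (hσ : IsUnitCubeCutoff σ) {j : ℤ} {k : Fin d → ℤ}
    {ξ : Rd d} (h : ξ ∉ freqCube j k) : cutoffAt σ j k ξ = 0 := by
  simp only [freqCube, Set.mem_ofPred_eq, not_forall, not_le] at h
  obtain ⟨i, hi⟩ := h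
  rw [cutoffAt, hσ.eq_zero _ ⟨i, by simpa [latticePoint] using hi⟩, Complex.ofReal_zero]

theorem volume_freqCube (j : ℤ) (k : Fin d → ℤ) :
    volume (freqCube j k : Set (Rd d)) = ENNReal.ofReal ((3 / 2 * (2 : ℝ) ^ j) ^ d) := by
  have h2 : (0 : ℝ) < 2 ^ j := by positivity
  have : (freqCube j k : Set (Rd d)) = WithLp.ofLp ⁻¹'
      Set.Icc (fun i => 2 ^ j * (k i - 3 / 4 : ℝ)) (fun i => 2 ^ j * (k i + 3 / 4 : ℝ)) := by
    ext ξ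
    simp only [freqCube, Set.mem_ofPred_eq, Set.mem_preimage, Set.mem_Icc, Pi.le_def,
      ← forall_and]
    refine forall_congr' fun i => ?_
    change _ ↔ _ ≤ ξ i ∧ ξ i ≤ _
    rw [abs_le, zpow_neg, inv_mul_eq_div, ← le_div_iff₀' h2, ← div_le_iff₀' h2]
    constructor <;> rintro ⟨h1, h2⟩ <;> constructor <;> linarith
  rw [this, (PiLp.volume_preserving_ofLp (Fin d)).measure_preimage
    measurableSet_Icc.nullMeasurableSet, Real.volume_Icc_pi]
  have : ∀ i : Fin d, (2 : ℝ) ^ j * (k i + 3 / 4) - 2 ^ j * (k i - 3 / 4) = 3 / 2 * 2 ^ j :=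
    fun i => by ring
  simp_rw [this]
  rw [Finset.prod_const, Finset.card_univ, Fintype.card_fin, ENNReal.ofReal_pow (by positivity)]

/-- The indices of the frequency cubes that may contain `ξ`. -/
def nearIndices (j : ℤ) (ξ : Rd d) : Finset (Fin d → ℤ) :=
  Fintype.piFinset fun i => Finset.Icc ⌈(2 : ℝ) ^ (-j) * ξ i - 3 / 4⌉ ⌊(2 : ℝ) ^ (-j) * ξ i + 3 / 4⌋

theorem mem_nearIndices {j : ℤ} {ξ : Rd d} {k : Fin d → ℤ} :
    k ∈ nearIndices j ξ ↔ ξ ∈ freqCube j k := by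
  simp only [nearIndices, Fintype.mem_piFinset, Finset.mem_Icc, Int.ceil_le, Int.le_floor, freqCube,
    Set.mem_ofPred_eq]
  refine forall_congr' fun i => ?_
  rw [abs_le]
  constructor <;> rintro ⟨h1, h2⟩ <;> constructor <;> linarith

/-- In each coordinate, a closed interval of length `3/2` contains at most two integers. -/
theorem card_nearIndices_le (j : ℤ) (ξ : Rd d) : (nearIndices j ξ).card ≤ 2 ^ d := by
  rw [nearIndices, Fintype.card_piFinset]
  refine (Finset.prod_le_pow_card _ _ 2 fun i _ => ?_).trans (by simp)
  rw [Int.card_Icc]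
  have h1 := Int.floor_le ((2 : ℝ) ^ (-j) * ξ i + 3 / 4)
  have h2 := Int.le_ceil ((2 : ℝ) ^ (-j) * ξ i - 3 / 4)
  have h3 : (⌊(2 : ℝ) ^ (-j) * ξ i + 3 / 4⌋ : ℝ) < ⌈(2 : ℝ) ^ (-j) * ξ i - 3 / 4⌉ + 2 := by linarith
  have h4 : ⌊(2 : ℝ) ^ (-j) * ξ i + 3 / 4⌋ < ⌈(2 : ℝ) ^ (-j) * ξ i - 3 / 4⌉ + 2 := by exact_mod_cast h3
  omega

/-- An exhaustion of `ℤ^d` by cubes. -/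
def indexBox (d : ℕ) (n : ℕ) : Finset (Fin d → ℤ) := Fintype.piFinset fun _ => Finset.Icc (-n : ℤ) n

theorem nearIndices_subset_indexBox {j : ℤ} {R : ℝ} {n : ℕ} (hn : (2 : ℝ) ^ (-j) * R + 1 ≤ n)
    {ξ : Rd d} (hξ : ‖ξ‖ ≤ R) : nearIndices j ξ ⊆ indexBox d n := by
  intro k hk
  rw [mem_nearIndices] at hk
  simp only [indexBox, Fintype.mem_piFinset, Finset.mem_Icc]
  intro i
  have h1 := abs_le.mp (hk i)
  have h2 : |ξ i| ≤ R := (PiLp.norm_apply_le ξ i).trans hξ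
  have h3 : |(2 : ℝ) ^ (-j) * ξ i| ≤ (2 : ℝ) ^ (-j) * R := by
    rw [abs_mul, abs_of_pos (by positivity)]
    gcongr
  have h4 := abs_le.mp h3
  constructor
  · have : (-n : ℝ) ≤ k i := by linarith
    exact_mod_cast this
  · have : (k i : ℝ) ≤ n := by linarith
    exact_mod_cast this

theorem sum_cutoffAt {σ : Rd d → ℝ} (hσ : IsUnitCubeCutoff σ) {j : ℤ} {ξ : Rd d}
    {F : Finset (Fin d → ℤ)} (hF : nearIndices j ξ ⊆ F) : ∑ k ∈ F, cutoffAt σ j k ξ = 1 := by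
  have h1 := hσ.partition ((2 : ℝ) ^ (-j) • ξ)
  have h2 : HasSum (fun k : Fin d → ℤ => cutoffAt σ j k ξ) 1 := by
    have := Complex.hasSum_ofReal.mpr h1
    simpa [cutoffAt] using this
  rw [← h2.tsum_eq]
  refine (tsum_eq_sum fun k hk => cutoffAt_eq_zero hσ fun hmem => hk (hF ?_)).symm
  exact mem_nearIndices.mpr hmem

/-! ### The estimate at a single scale -/

theorem fourierT_box_apply {σ : Rd d → ℝ} (j : ℤ) (k : Fin d → ℤ) (f : 𝓢'(Rd d, ℂ))
    (φ : 𝓢(Rd d, ℂ)) :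
    fourierT (box σ j k f) φ = fourierT f (SchwartzMap.smulLeftCLM ℂ (cutoffAt σ j k) φ) := by
  rw [box, fourierT_fourierInvT, TemperedDistribution.smulLeftCLM_apply_apply]

/-- A test function supported off the cube is annihilated by the cutoff, so `h` integrates to zero
against it. -/
theorem ae_eq_indicator_freqCube {σ : Rd d → ℝ} (hσ : IsUnitCubeCutoff σ) {j : ℤ}
    {k : Fin d → ℤ} {f : 𝓢'(Rd d, ℂ)} {h : Rd d → ℂ} (hh : LocallyIntegrable h volume)
    (hf : ∀ φ : 𝓢(Rd d, ℂ), fourierT (box σ j k f) φ = ∫ x, φ x * h x) :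
    h =ᵐ[volume] (freqCube j k).indicator h := by
  have := (isClosed_freqCube (d := d) j k).isOpen_compl.ae_eq_zero_of_integral_contDiff_smul_eq_zero
    (hh.locallyIntegrableOn _) (μ := volume) fun g hg hgc hgs => by
      have h₁ : HasCompactSupport (Complex.ofRealCLM ∘ g) := hgc.comp_left rfl
      have h₂ : ContDiff ℝ (⊤ : ℕ∞) (Complex.ofRealCLM ∘ g) := by fun_prop
      have h3 : SchwartzMap.smulLeftCLM ℂ (cutoffAt σ j k) (h₁.toSchwartzMap h₂) = 0 := by
        ext x
        rw [SchwartzMap.smulLeftCLM_apply_apply (hσ.hasTemperateGrowth j k)]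
        change cutoffAt σ j k x • ((g x : ℝ) : ℂ) = 0
        by_cases hx : x ∈ freqCube j k
        · have : g x = 0 := by
            by_contra hne
            exact hgs (subset_tsupport g hne) hx
          simp [this]
        · simp [cutoffAt_eq_zero hσ hx]
      have h4 := hf (h₁.toSchwartzMap h₂)
      rw [fourierT_box_apply, h3, map_zero] at h4
      rw [h4]
      congr 1 with x
  filter_upwards [this] with x hx
  by_cases hmem : x ∈ freqCube j k
  · rw [Set.indicator_of_mem hmem]
  · rw [Set.indicator_of_notMem hmem, hx hmem]

/-- Hölder on a set of measure `(3/2 · 2^j)^d`. The power of `3/2` is rounded up to `d`, which is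
allowed since `1/r - 1/s ≤ 1`; the power of `2^j` is kept exactly. -/
theorem eLpNorm_indicator_freqCube_le {r s : ℝ≥0∞} (hr : 1 ≤ r) (hrs : r ≤ s) {h : Rd d → ℂ}
    (hh : AEStronglyMeasurable h volume) (j : ℤ) (k : Fin d → ℤ) :
    eLpNorm ((freqCube j k).indicator h) r volume ≤
      ENNReal.ofReal ((3 / 2 : ℝ) ^ d * (2 : ℝ) ^ (j * (d * (r⁻¹.toReal - s⁻¹.toReal)) : ℝ)) *
        eLpNorm h s volume := by
  have hm := (isClosed_freqCube (d := d) j k).measurableSet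
  set e : ℝ := r⁻¹.toReal - s⁻¹.toReal with he
  have he0 : 0 ≤ e := by
    have := ENNReal.toReal_mono (ENNReal.inv_ne_top.mpr (zero_lt_one.trans_le hr).ne')
      (ENNReal.inv_le_inv.mpr hrs)
    rw [he]; linarith
  have he1 : e ≤ 1 := by
    have : r⁻¹.toReal ≤ 1 := by
      simpa using ENNReal.toReal_mono ENNReal.one_ne_top (ENNReal.inv_le_one.mpr hr)
    have := ENNReal.toReal_nonneg (a := s⁻¹)
    rw [he]; linarith
  rw [eLpNorm_indicator_eq_eLpNorm_restrict hm]
  refine (eLpNorm_le_eLpNorm_mul_rpow_measure_univ hrs hh.restrict).trans ?_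
  rw [Measure.restrict_apply_univ, volume_freqCube, mul_comm, one_div, one_div,
    ← ENNReal.toReal_inv, ← ENNReal.toReal_inv]
  refine mul_le_mul' ?_ (eLpNorm_mono_measure _ Measure.restrict_le_self)
  rw [ENNReal.ofReal_rpow_of_pos (by positivity)]
  refine ENNReal.ofReal_le_ofReal ?_
  change ((3 / 2 * (2 : ℝ) ^ j) ^ d) ^ e ≤ _
  rw [mul_pow, Real.mul_rpow (by positivity) (by positivity)]
  have h1 : (((2 : ℝ) ^ j) ^ d) ^ e = (2 : ℝ) ^ (j * (d * e) : ℝ) := by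
    rw [← Real.rpow_natCast, ← Real.rpow_mul (by positivity), ← Real.rpow_intCast,
      ← Real.rpow_mul (by norm_num)]
  rw [h1]
  gcongr
  calc ((3 / 2 : ℝ) ^ d) ^ e ≤ ((3 / 2 : ℝ) ^ d) ^ (1 : ℝ) :=
        Real.rpow_le_rpow_of_exponent_le (one_le_pow₀ (by norm_num)) he1
    _ = _ := Real.rpow_one _

/-- Gluing of functions carried by the frequency cubes. -/
def glue (j : ℤ) (h : (Fin d → ℤ) → Rd d → ℂ) (ξ : Rd d) : ℂ :=
  ∑ k ∈ nearIndices j ξ, (freqCube j k).indicator (h k) ξ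

theorem glue_eq_sum (j : ℤ) (h : (Fin d → ℤ) → Rd d → ℂ) {ξ : Rd d} {F : Finset (Fin d → ℤ)}
    (hF : nearIndices j ξ ⊆ F) : glue j h ξ = ∑ k ∈ F, (freqCube j k).indicator (h k) ξ :=
  Finset.sum_subset hF fun _ _ hk =>
    Set.indicator_of_notMem (fun hmem => hk (mem_nearIndices.mpr hmem)) _

theorem aestronglyMeasurable_glue (j : ℤ) {h : (Fin d → ℤ) → Rd d → ℂ}
    (hh : ∀ k, AEStronglyMeasurable (h k) volume) : AEStronglyMeasurable (glue j h) volume := by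
  refine aestronglyMeasurable_of_tendsto_ae atTop (f := fun n : ℕ => fun ξ =>
    ∑ k ∈ indexBox d n, (freqCube j k).indicator (h k) ξ) (fun n => ?_)
    (Eventually.of_forall fun ξ => ?_)
  · exact Finset.aestronglyMeasurable_fun_sum _ fun k _ =>
      (hh k).indicator (isClosed_freqCube (d := d) j k).measurableSet
  · refine tendsto_const_nhds.congr' ?_
    obtain ⟨N, hN⟩ := exists_nat_ge ((2 : ℝ) ^ (-j) * ‖ξ‖ + 1)
    filter_upwards [eventually_ge_atTop N] with n hn
    exact glue_eq_sum j h (nearIndices_subset_indexBox (hN.trans (by exact_mod_cast hn)) le_rfl)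

/-- Hausdorff–Young on each piece, Hölder on each cube, then bounded overlap. The exponent `r`
serves both as integrability and as summability index, and `C` does not depend on the scale. -/
theorem exists_fourierT_single_scale {σ : Rd d → ℝ} (hσ : IsUnitCubeCutoff σ) {p r : ℝ≥0∞}
    [Fact (1 ≤ p)] [Fact (1 ≤ r)] (hp2 : p ≤ 2) (hr : r ≤ p.conjExponent) :
    ∃ C : ℝ≥0, ∀ (j : ℤ) (f : 𝓢'(Rd d, ℂ)), modulationNorm σ j p r f < ∞ → ∃ H : Rd d → ℂ,
      MemLp H r volume ∧ (∀ φ : 𝓢(Rd d, ℂ), fourierT f φ = ∫ x, φ x * H x) ∧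
      eLpNorm H r volume ≤ C * (ENNReal.ofReal
        ((2 : ℝ) ^ (j * (d * (r⁻¹.toReal - p.conjExponent⁻¹.toReal)) : ℝ)) *
          modulationNorm σ j p r f) := by
  have hr1 : 1 ≤ r := Fact.out
  have hpc : 1 ≤ p.conjExponent := le_self_add
  obtain ⟨C, hC⟩ := exists_hausdorff_young_fourierT d hp2
  refine ⟨2 ^ d * ((3 / 2 : ℝ) ^ d).toNNReal * C, fun j f hf => ?_⟩
  have hfin : ∀ k, lpNormT p (box σ j k f) < ∞ := fun k => (le_ellNorm hr1 _ k).trans_lt hf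
  choose h hmem hrep hnorm using fun k => hC _ (hfin k)
  have hloc : ∀ k, LocallyIntegrable (h k) volume := fun k => (hmem k).locallyIntegrable hpc
  set E : ℝ≥0∞ := ENNReal.ofReal
    ((2 : ℝ) ^ (j * (d * (r⁻¹.toReal - p.conjExponent⁻¹.toReal)) : ℝ)) with hE
  have hbound : eLpNorm (glue j h) r volume ≤
      (2 ^ d * ((3 / 2 : ℝ) ^ d).toNNReal * C : ℝ≥0) * (E * modulationNorm σ j p r f) := by
    refine (eLpNorm_le_ellNorm_of_overlap (M := 2 ^ d) (h := fun k => (freqCube j k).indicator (h k))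
      hr1 (fun k => (hmem k).1.indicator (isClosed_freqCube (d := d) j k).measurableSet)
      fun ξ => ⟨nearIndices j ξ, card_nearIndices_le j ξ, enorm_sum_le _ _⟩).trans ?_
    have h1 : ellNorm r (fun k => eLpNorm ((freqCube j k).indicator (h k)) r volume) ≤
        ellNorm r fun k => ENNReal.ofReal ((3 / 2 : ℝ) ^ d) * E * C * lpNormT p (box σ j k f) := by
      refine ellNorm_mono r fun k => (eLpNorm_indicator_freqCube_le hr1 hr (hmem k).1 j k).trans ?_
      rw [ENNReal.ofReal_mul (by positivity), mul_assoc _ (C : ℝ≥0∞)]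
      gcongr
      exact hnorm k
    rw [ellNorm_const_mul hr1] at h1
    calc _ ≤ ((2 ^ d : ℕ) : ℝ≥0∞) * (ENNReal.ofReal ((3 / 2 : ℝ) ^ d) * E * C *
          modulationNorm σ j p r f) := by gcongr; exact h1
      _ = _ := by
        rw [ENNReal.ofReal]
        push_cast
        ring
  have hglue : MemLp (glue j h) r volume := by
    refine ⟨aestronglyMeasurable_glue j fun k => (hmem k).1, hbound.trans_lt ?_⟩
    exact ENNReal.mul_lt_top ENNReal.coe_lt_top (ENNReal.mul_lt_top ENNReal.ofReal_lt_top hf)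
  refine ⟨glue j h, hglue, ?_, hbound⟩
  -- Compactly supported test functions suffice, and their supports meet only finitely many cubes,
  -- so the partition of unity becomes a finite sum.
  have hext : fourierT f = Lp.toTemperedDistribution (hglue.toLp _) := by
    refine temperedDistribution_ext_compactSupport fun φ hφ => ?_
    have h1 : Lp.toTemperedDistribution (hglue.toLp _) φ = ∫ x, φ x * glue j h x := by
      rw [Lp.toTemperedDistribution_apply]
      refine integral_congr_ae ?_
      filter_upwards [hglue.coeFn_toLp] with x hx
      rw [hx, smul_eq_mul]
    rw [h1]
    obtain ⟨R, hR⟩ := hφ.isCompact.isBounded.exists_norm_le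
    obtain ⟨n, hn⟩ := exists_nat_ge ((2 : ℝ) ^ (-j) * R + 1)
    have hsupp : ∀ x, φ x ≠ 0 → nearIndices j x ⊆ indexBox d n := fun x hx =>
      nearIndices_subset_indexBox hn (hR x (subset_tsupport _ hx))
    have hsum : φ = ∑ k ∈ indexBox d n, SchwartzMap.smulLeftCLM ℂ (cutoffAt σ j k) φ := by
      ext x
      rw [sum_apply]
      simp_rw [SchwartzMap.smulLeftCLM_apply_apply (hσ.hasTemperateGrowth j _)]
      rw [← Finset.sum_smul]
      by_cases hx : φ x = 0
      · simp [hx]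
      · rw [sum_cutoffAt hσ (hsupp x hx), one_smul]
    conv_lhs => rw [hsum]
    rw [map_sum]
    simp_rw [← fourierT_box_apply, hrep]
    rw [← integral_finsetSum _ fun k _ => integrable_schwartz_mul hpc (hmem k) φ]
    have hae : ∀ᵐ x : Rd d, ∀ k, h k x = (freqCube j k).indicator (h k) x :=
      ae_all_iff.mpr fun k => ae_eq_indicator_freqCube hσ (hloc k) (hrep k)
    refine integral_congr_ae ?_
    filter_upwards [hae] with x hx
    by_cases hx0 : φ x = 0
    · simp [hx0]
    · rw [glue_eq_sum j h (hsupp x hx0), Finset.mul_sum]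
      exact Finset.sum_congr rfl fun k _ => by rw [← hx k]
  intro φ
  rw [hext, Lp.toTemperedDistribution_apply]
  refine integral_congr_ae ?_
  filter_upwards [hglue.coeFn_toLp] with x hx
  rw [hx, smul_eq_mul]

/-! ### Sufficiency -/

theorem toReal_inv_conjExponent {p : ℝ≥0∞} (hp : 1 ≤ p) :
    p.conjExponent⁻¹.toReal = 1 - p⁻¹.toReal := by
  have := ENNReal.HolderConjugate.conjExponent hp
  have h := ENNReal.HolderConjugate.inv_add_inv_eq_one p p.conjExponent
  have h1 : p⁻¹ ≠ ∞ := ENNReal.inv_ne_top.mpr (zero_lt_one.trans_le hp).ne'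
  have h2 : p.conjExponent⁻¹ ≠ ∞ :=
    ENNReal.inv_ne_top.mpr (zero_lt_one.trans_le (le_self_add : 1 ≤ p.conjExponent)).ne'
  have := congrArg ENNReal.toReal h
  rw [ENNReal.toReal_add h1 h2, ENNReal.toReal_one] at this
  linarith

/-- The transforms of the pieces are absolutely summable in `L^r`; as `L^r` embeds continuously in
`𝓢'`, their sum there must be the transform of `u`. -/
theorem fourierLebesgueNorm_le_cost {σ : Rd d → ℝ} (hσ : IsUnitCubeCutoff σ) {p q r : ℝ≥0∞}
    [Fact (1 ≤ p)] [Fact (1 ≤ q)] [Fact (1 ≤ r)] {μ : ℝ} (hp2 : p ≤ 2) (hqr : q ≤ r)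
    (hr : r ≤ p.conjExponent) (hμ : μ ≤ d * (r⁻¹.toReal - p.conjExponent⁻¹.toReal)) :
    ∃ C : ℝ≥0, 1 ≤ C ∧ ∀ (u : 𝓢'(Rd d, ℂ)) (f : ℕ → 𝓢'(Rd d, ℂ)), IsDecomposition σ p q u f →
      fourierLebesgueNorm r u ≤ C * decompositionCost σ p q μ f := by
  obtain ⟨C, hC⟩ := exists_fourierT_single_scale hσ hp2 hr
  -- The added `1` makes the constant nonzero, so that it absorbs an infinite cost and can later be
  -- divided by.
  refine ⟨C + 1, le_add_self, fun u f hf => ?_⟩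
  rcases eq_or_ne (decompositionCost σ p q μ f) ∞ with htop | hfin
  · rw [htop, ENNReal.mul_top (by simp)]
    exact le_top
  have hqr' : ∀ n : ℕ, modulationNorm σ (-(n : ℤ)) p r (f n) ≤
      modulationNorm σ (-(n : ℤ)) p q (f n) :=
    fun n => ellNorm_antitone Fact.out hqr _
  choose H hmem hrep hnorm using fun n : ℕ => hC (-(n : ℤ)) (f n) ((hqr' n).trans_lt (hf.mem n))
  set g : ℕ → Lp ℂ r (volume : Measure (Rd d)) := fun n => (hmem n).toLp (H n) with hg
  have hgT : ∀ n, Lp.toTemperedDistribution (g n) = fourierT (f n) := fun n => by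
    ext φ
    rw [hrep, Lp.toTemperedDistribution_apply]
    refine integral_congr_ae ?_
    filter_upwards [(hmem n).coeFn_toLp] with x hx
    rw [hx, smul_eq_mul]
  have hgn : ∀ n : ℕ, ‖g n‖ₑ ≤ C * (ENNReal.ofReal ((2 : ℝ) ^ (-(n : ℝ) * μ)) *
      modulationNorm σ (-(n : ℤ)) p q (f n)) := fun n => by
    rw [hg, Lp.enorm_toLp]
    refine (hnorm n).trans ?_
    refine mul_le_mul' le_rfl (mul_le_mul' (ENNReal.ofReal_le_ofReal
      (Real.rpow_le_rpow_of_exponent_le one_le_two ?_)) (hqr' n))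
    push_cast
    nlinarith [n.cast_nonneg (α := ℝ)]
  have hsum : ∑' n, ‖g n‖ₑ ≤ C * decompositionCost σ p q μ f := by
    rw [decompositionCost, ← ENNReal.tsum_mul_left]
    exact ENNReal.tsum_le_tsum hgn
  have hsumm : Summable g := by
    refine Summable.of_nnnorm ?_
    rw [← ENNReal.tsum_coe_ne_top_iff_summable]
    exact (hsum.trans_lt (ENNReal.mul_lt_top ENNReal.coe_lt_top hfin.lt_top)).ne
  have hlim1 : Tendsto (fun N => fourierT (∑ n ∈ Finset.range N, f n)) atTop (𝓝 (fourierT u)) :=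
    (continuous_fourierT.tendsto u).comp hf.tendsto
  have hlim2 := ((Lp.toTemperedDistributionCLM ℂ (volume : Measure (Rd d)) r).continuous.tendsto
    _).comp hsumm.hasSum.tendsto_sum_nat
  have hu : fourierT u = Lp.toTemperedDistribution (∑' n, g n) := by
    refine tendsto_nhds_unique hlim1 (hlim2.congr fun N => ?_)
    rw [Function.comp_apply, map_sum, fourierT_sum]
    exact Finset.sum_congr rfl fun n _ => hgT n
  rw [fourierLebesgueNorm, hu, lpNormT_coe]
  have h1 : ‖∑' n, g n‖ₑ ≤ ∑' n, ‖g n‖ₑ := enorm_tsum_le_tsum_enorm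
  refine (h1.trans hsum).trans ?_
  gcongr
  simp

theorem embedsInFourierLebesgue_of_le {σ : Rd d → ℝ} (hσ : IsUnitCubeCutoff σ) {p q r : ℝ≥0∞}
    [Fact (1 ≤ p)] [Fact (1 ≤ q)] [Fact (1 ≤ r)] {μ : ℝ} (hp2 : p ≤ 2) (hqr : q ≤ r)
    (hr : r ≤ p.conjExponent) (hμ : μ ≤ d * (r⁻¹.toReal - p.conjExponent⁻¹.toReal)) :
    EmbedsInFourierLebesgue σ p q r μ := by
  obtain ⟨C, hC1, hC⟩ := fourierLebesgueNorm_le_cost hσ hp2 hqr hr hμ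
  refine ⟨fun u ⟨f, hf, hc⟩ => (hC u f hf).trans_lt (ENNReal.mul_lt_top ENNReal.coe_lt_top hc),
    C, fun u _ => ?_⟩
  have hC0 : (C : ℝ≥0∞) ≠ 0 := by
    have := zero_lt_one.trans_le hC1
    exact_mod_cast this.ne'
  rw [mul_comm, ← ENNReal.div_le_iff hC0 ENNReal.coe_ne_top, scalingLimitNorm]
  refine le_iInf₂ fun f hf => ?_
  rw [ENNReal.div_le_iff hC0 ENNReal.coe_ne_top, mul_comm]
  exact hC u f hf

/-! ### The embedding tested on band-limited functions -/

theorem ellNorm_le_card_rpow {ι : Type*} {q : ℝ≥0∞} (hq : 1 ≤ q) {A : Finset ι} {a : ι → ℝ≥0∞}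
    {B : ℝ≥0∞} (hB : ∀ k ∈ A, a k ≤ B) (h0 : ∀ k ∉ A, a k = 0) :
    ellNorm q a ≤ (A.card : ℝ≥0∞) ^ q⁻¹.toReal * B := by
  by_cases hqt : q = ∞
  · subst hqt
    rw [ellNorm, if_pos rfl]
    simp only [ENNReal.inv_top, ENNReal.toReal_zero, ENNReal.rpow_zero, one_mul]
    refine iSup_le fun k => ?_
    by_cases hk : k ∈ A
    · exact hB k hk
    · rw [h0 k hk]; exact zero_le
  have hpos : 0 < q.toReal := ENNReal.toReal_pos (zero_lt_one.trans_le hq).ne' hqt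
  rw [ellNorm, if_neg hqt, tsum_eq_sum (s := A) fun k hk => by
    rw [h0 k hk, ENNReal.zero_rpow_of_pos hpos]]
  calc (∑ k ∈ A, a k ^ q.toReal) ^ (1 / q.toReal)
      ≤ ((A.card : ℝ≥0∞) * B ^ q.toReal) ^ (1 / q.toReal) := by
        refine ENNReal.rpow_le_rpow ?_ (by positivity)
        refine (Finset.sum_le_card_nsmul A _ (B ^ q.toReal) fun k hk =>
          ENNReal.rpow_le_rpow (hB k hk) hpos.le).trans (by rw [nsmul_eq_mul])
    _ = _ := by
        rw [ENNReal.mul_rpow_of_nonneg _ _ (by positivity), ← ENNReal.rpow_mul,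
          mul_one_div_cancel hpos.ne', ENNReal.rpow_one, one_div, ENNReal.toReal_inv]

/-- Being within `1/4` of `k_i` and `3/4` of `k'_i` would put these integers at distance less than
`1`. -/
theorem notMem_freqCube_of_near {n : ℕ} {k k' : Fin d → ℤ} (hne : k' ≠ k) {ξ : Rd d}
    (h : ∀ i, |(2 : ℝ) ^ n * ξ i - k i| < 1 / 4) : ξ ∉ freqCube (-(n : ℤ)) k' := by
  intro hmem
  refine hne (funext fun i => ?_)
  have h1 := hmem i
  simp only [neg_neg, zpow_natCast] at h1
  have h2 : |((k' i - k i : ℤ) : ℝ)| < 1 := by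
    have := abs_sub_le (k' i : ℝ) ((2 : ℝ) ^ n * ξ i) (k i)
    rw [abs_sub_comm (k' i : ℝ) ((2 : ℝ) ^ n * ξ i)] at this
    push_cast
    linarith [h i]
  have h3 : |k' i - k i| < 1 := by exact_mod_cast h2
  have := Int.abs_lt_one_iff.mp h3
  omega

/-- All other cutoffs vanish there, so the partition of unity forces the remaining one to be `1`;
nothing else about `σ` is needed. -/
theorem cutoffAt_of_near {σ : Rd d → ℝ} (hσ : IsUnitCubeCutoff σ) {n : ℕ} {k : Fin d → ℤ}
    (k' : Fin d → ℤ) {ξ : Rd d} (h : ∀ i, |(2 : ℝ) ^ n * ξ i - k i| < 1 / 4) :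
    cutoffAt σ (-(n : ℤ)) k' ξ = if k' = k then 1 else 0 := by
  have hzero : ∀ k' ≠ k, cutoffAt σ (-(n : ℤ)) k' ξ = 0 := fun k' hne =>
    cutoffAt_eq_zero hσ (notMem_freqCube_of_near hne h)
  split_ifs with hk
  · subst hk
    have h1 := sum_cutoffAt hσ (j := -(n : ℤ)) (ξ := ξ)
      (F := insert k' (nearIndices (-(n : ℤ)) ξ)) (Finset.subset_insert _ _)
    rwa [Finset.sum_eq_single k' (fun b _ hb => hzero b hb) (fun hn => by simp at hn)] at h1
  · exact hzero k' hk

theorem box_sum_of_near {σ : Rd d → ℝ} (hσ : IsUnitCubeCutoff σ) {n : ℕ}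
    {A : Finset (Fin d → ℤ)} {ψ : (Fin d → ℤ) → 𝓢(Rd d, ℂ)}
    (hψ : ∀ k ∈ A, ∀ ξ, ψ k ξ ≠ 0 → ∀ i, |(2 : ℝ) ^ n * ξ i - k i| < 1 / 4) (k' : Fin d → ℤ) :
    box σ (-(n : ℤ)) k' (fourierInvT ((∑ k ∈ A, ψ k : 𝓢(Rd d, ℂ)) : 𝓢'(Rd d, ℂ))) =
      fourierInvT ((if k' ∈ A then ψ k' else 0 : 𝓢(Rd d, ℂ)) : 𝓢'(Rd d, ℂ)) := by
  have h1 : fourierT (fourierInvT ((∑ k ∈ A, ψ k : 𝓢(Rd d, ℂ)) : 𝓢'(Rd d, ℂ))) =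
      ((∑ k ∈ A, ψ k : 𝓢(Rd d, ℂ)) : 𝓢'(Rd d, ℂ)) := fourierT_fourierInvT _
  rw [box, h1]
  congr 1
  ext φ
  rw [TemperedDistribution.smulLeftCLM_apply_apply, schwartz_coe_apply, schwartz_coe_apply]
  congr 1 with x
  rw [SchwartzMap.smulLeftCLM_apply_apply (hσ.hasTemperateGrowth _ _), smul_eq_mul, mul_comm _ (φ x),
    mul_assoc, sum_apply, Finset.mul_sum]
  congr 1
  have hterm : ∀ k ∈ A, cutoffAt σ (-(n : ℤ)) k' x * ψ k x = if k' = k then ψ k x else 0 := by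
    intro k hk
    by_cases h0 : ψ k x = 0
    · simp [h0]
    · rw [cutoffAt_of_near hσ k' (hψ k hk x h0)]
      split_ifs <;> simp
  rw [Finset.sum_congr rfl hterm, Finset.sum_ite_eq]
  split_ifs <;> simp

/-- The embedding, tested on a function with spectrum in the central parts of finitely many
frequency cubes of the scale `2^{-n}`. -/
theorem EmbedsInFourierLebesgue.test {σ : Rd d → ℝ} (hσ : IsUnitCubeCutoff σ) {p q r : ℝ≥0∞}
    [Fact (1 ≤ p)] [Fact (1 ≤ q)] [Fact (1 ≤ r)] {μ : ℝ} (h : EmbedsInFourierLebesgue σ p q r μ) :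
    ∃ C : ℝ≥0, ∀ (n : ℕ) (A : Finset (Fin d → ℤ)) (ψ : (Fin d → ℤ) → 𝓢(Rd d, ℂ)) (B : ℝ≥0∞),
      B ≠ ∞ → (∀ k ∈ A, ∀ ξ, ψ k ξ ≠ 0 → ∀ i, |(2 : ℝ) ^ n * ξ i - k i| < 1 / 4) →
      (∀ k ∈ A, eLpNorm (𝓕⁻ (ψ k) : 𝓢(Rd d, ℂ)) p volume ≤ B) →
      eLpNorm (∑ k ∈ A, ψ k : 𝓢(Rd d, ℂ)) r volume ≤
        C * (ENNReal.ofReal ((2 : ℝ) ^ (-(n : ℝ) * μ)) * ((A.card : ℝ≥0∞) ^ q⁻¹.toReal * B)) := by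
  obtain ⟨-, C, hC⟩ := h
  set c : ℝ := ((2 * Real.pi) ^ d)⁻¹ *
    (2 * Real.pi)⁻¹ ^ (-(Module.finrank ℝ (Rd d) * p⁻¹.toReal)) with hc
  refine ⟨C * c.toNNReal, fun n A ψ B hBtop hψ hB => ?_⟩
  set u : 𝓢'(Rd d, ℂ) := fourierInvT ((∑ k ∈ A, ψ k : 𝓢(Rd d, ℂ)) : 𝓢'(Rd d, ℂ)) with hu
  have hmod : modulationNorm σ (-(n : ℤ)) p q u ≤
      (A.card : ℝ≥0∞) ^ q⁻¹.toReal * (ENNReal.ofReal c * B) := by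
    refine ellNorm_le_card_rpow Fact.out (fun k hk => ?_) (fun k hk => ?_)
    · rw [hu, box_sum_of_near hσ hψ, if_pos hk, lpNormT_fourierInvT]
      gcongr
      exact hB k hk
    · rw [hu, box_sum_of_near hσ hψ, if_neg hk, lpNormT_fourierInvT]
      have : (𝓕⁻ (0 : 𝓢(Rd d, ℂ))) = 0 := map_zero (FourierTransform.fourierInvCLM ℂ 𝓢(Rd d, ℂ))
      rw [this, FunLike.coe_zero, eLpNorm_zero, mul_zero]
  have hmodlt : modulationNorm σ (-(n : ℤ)) p q u < ∞ := by
    refine hmod.trans_lt (ENNReal.mul_lt_top (ENNReal.rpow_lt_top_of_nonneg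
      ENNReal.toReal_nonneg (by simp)) (ENNReal.mul_lt_top ENNReal.ofReal_lt_top hBtop.lt_top))
  have hmod0 : ∀ j : ℤ, modulationNorm σ j p q (0 : 𝓢'(Rd d, ℂ)) = 0 := by
    intro j
    have h0 : ∀ k, lpNormT p (box σ j k (0 : 𝓢'(Rd d, ℂ))) ≤ 0 := fun k => by
      rw [box, fourierT_zero, map_zero, fourierInvT_zero]
      refine le_of_eq ?_
      rw [lpNormT_eq_eLpNorm (h := (0 : Rd d → ℂ)) MemLp.zero (by simp), eLpNorm_zero]
    refine le_antisymm ((ellNorm_le_card_rpow (A := ∅) (B := 0) Fact.out (by simp)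
      fun k _ => le_antisymm (h0 k) zero_le).trans (by simp)) zero_le
  -- One decomposition, concentrated at scale `2^{-n}`, is enough: the norm is an infimum and only
  -- an upper bound for it is required.
  set f : ℕ → 𝓢'(Rd d, ℂ) := fun m => if m = n then u else 0 with hf
  have hdec : IsDecomposition σ p q u f := by
    refine ⟨fun m => ?_, ?_⟩
    · by_cases hm : m = n
      · rw [hf, hm]
        simpa [modulationSpace] using hmodlt
      · simp only [hf, if_neg hm]
        change modulationNorm σ _ p q 0 < ∞
        rw [hmod0]
        exact ENNReal.zero_lt_top
    · refine tendsto_const_nhds.congr' ?_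
      filter_upwards [eventually_gt_atTop n] with N hN
      rw [hf, Finset.sum_ite_eq', if_pos (Finset.mem_range.mpr hN)]
  have hcost : decompositionCost σ p q μ f =
      ENNReal.ofReal ((2 : ℝ) ^ (-(n : ℝ) * μ)) * modulationNorm σ (-(n : ℤ)) p q u := by
    rw [decompositionCost, tsum_eq_single n fun m hm => by
      simp only [hf, if_neg hm, hmod0, mul_zero]]
    simp [hf]
  have hmem : u ∈ scalingLimitSpace σ p q μ := ⟨f, hdec, by
    rw [hcost]; exact ENNReal.mul_lt_top ENNReal.ofReal_lt_top hmodlt⟩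
  have h1 := hC u hmem
  rw [fourierLebesgueNorm, hu, fourierT_fourierInvT, lpNormT_schwartz] at h1
  refine h1.trans ?_
  calc (C : ℝ≥0∞) * scalingLimitNorm σ p q μ u
      ≤ C * (ENNReal.ofReal ((2 : ℝ) ^ (-(n : ℝ) * μ)) *
          ((A.card : ℝ≥0∞) ^ q⁻¹.toReal * (ENNReal.ofReal c * B))) := by
        refine mul_le_mul' le_rfl ((iInf₂_le f hdec).trans ?_)
        rw [hcost]
        exact mul_le_mul' le_rfl hmod
    _ = _ := by
        rw [ENNReal.ofReal, ENNReal.ofReal]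
        push_cast
        ring

/-! ### Necessity -/

theorem nonpos_of_two_rpow_le {x K : ℝ} (h : ∀ m : ℕ, (2 : ℝ) ^ (m * x : ℝ) ≤ K) : x ≤ 0 := by
  by_contra! hx
  have h1 : Tendsto (fun m : ℕ => ((2 : ℝ) ^ x) ^ m) atTop atTop :=
    tendsto_pow_atTop_atTop_of_one_lt (Real.one_lt_rpow one_lt_two hx)
  obtain ⟨m, hm⟩ := (h1.eventually_gt_atTop K).exists
  refine absurd (h m) (not_le.mpr ?_)
  rwa [mul_comm, Real.rpow_mul_natCast (by norm_num)]

variable (d) in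
/-- A nonzero Schwartz function with small compact support. -/
def smallBump : ContDiffBump (0 : Rd d) where
  rIn := 1 / 16
  rOut := 1 / 8
  rIn_pos := by norm_num
  rIn_lt_rOut := by norm_num

theorem contDiff_smallBump : ContDiff ℝ (⊤ : ℕ∞) (fun x : Rd d => ((smallBump d x : ℝ) : ℂ)) :=
  Complex.ofRealCLM.contDiff.comp (smallBump d).contDiff

theorem hasCompactSupport_smallBump :
    HasCompactSupport (fun x : Rd d => ((smallBump d x : ℝ) : ℂ)) :=
  (smallBump d).hasCompactSupport.comp_left (g := fun r : ℝ => (r : ℂ)) (by simp)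

variable (d) in
/-- `smallBump` as a Schwartz function. -/
def bumpS : 𝓢(Rd d, ℂ) := hasCompactSupport_smallBump.toSchwartzMap contDiff_smallBump

theorem bumpS_apply (x : Rd d) : bumpS d x = ((smallBump d x : ℝ) : ℂ) := rfl

theorem norm_lt_of_bumpS_ne_zero {x : Rd d} (h : bumpS d x ≠ 0) : ‖x‖ < 1 / 8 := by
  by_contra! hcon
  refine h ?_
  rw [bumpS_apply, (smallBump d).zero_of_le_dist (by simpa [smallBump] using hcon),
    Complex.ofReal_zero]

theorem abs_lt_of_bumpS_ne_zero {x : Rd d} (h : bumpS d x ≠ 0) (i : Fin d) : |x i| < 1 / 4 := by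
  have h1 : |x i| ≤ ‖x‖ := PiLp.norm_apply_le x i
  linarith [norm_lt_of_bumpS_ne_zero h]

theorem eLpNorm_ne_zero_of_apply_zero {f : Rd d → ℂ} (hf : Continuous f) (h0 : f 0 ≠ 0) {r : ℝ≥0∞}
    (hr : r ≠ 0) : eLpNorm f r volume ≠ 0 := by
  rw [Ne, eLpNorm_eq_zero_iff hf.aestronglyMeasurable hr]
  intro h
  have := (Continuous.ae_eq_iff_eq volume hf continuous_const).mp h
  exact h0 (congrFun this 0)

theorem bumpS_zero : bumpS d 0 = 1 := by
  rw [bumpS_apply, (smallBump d).one_of_mem_closedBall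
    (Metric.mem_closedBall_self (smallBump d).rIn_pos.le), Complex.ofReal_one]

theorem eLpNorm_bumpS_ne_zero {r : ℝ≥0∞} (hr : 1 ≤ r) : eLpNorm (bumpS d) r volume ≠ 0 :=
  eLpNorm_ne_zero_of_apply_zero (bumpS d).continuous (by rw [bumpS_zero]; exact one_ne_zero)
    (zero_lt_one.trans_le hr).ne'

/-! ### Dilated bumps -/

/-- `φ(2^m ·)` for the small bump `φ`. -/
def dilatedBumpS (d m : ℕ) : 𝓢(Rd d, ℂ) :=
  compCLMOfContinuousLinearEquiv ℂ (dilation d ((2 : ℝ) ^ m) (by positivity)) (bumpS d)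

theorem dilatedBumpS_apply (m : ℕ) (x : Rd d) : dilatedBumpS d m x = bumpS d ((2 : ℝ) ^ m • x) :=
  rfl

theorem fourierInv_dilatedBumpS (m : ℕ) (x : Rd d) :
    𝓕⁻ (dilatedBumpS d m) x = (((2 : ℝ) ^ m) ^ d)⁻¹ • 𝓕⁻ (bumpS d) (((2 : ℝ) ^ m)⁻¹ • x) := by
  have h2 : (0 : ℝ) < 2 ^ m := by positivity
  rw [SchwartzMap.fourierInv_coe, SchwartzMap.fourierInv_coe, Real.fourierInv_eq,
    Real.fourierInv_eq]
  have h := Measure.integral_comp_smul (volume : Measure (Rd d))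
    (fun v => Real.fourierChar (inner ℝ v (((2 : ℝ) ^ m)⁻¹ • x)) • bumpS d v) ((2 : ℝ) ^ m)
  rw [finrank_euclideanSpace_fin, abs_of_nonneg (by positivity)] at h
  rw [← h]
  congr 1 with v
  rw [dilatedBumpS_apply, inner_smul_left, inner_smul_right]
  simp only [conj_trivial]
  rw [mul_inv_cancel_left₀ h2.ne']

theorem eLpNorm_fourierInv_dilatedBumpS (p : ℝ≥0∞) (m : ℕ) :
    eLpNorm (𝓕⁻ (dilatedBumpS d m) : 𝓢(Rd d, ℂ)) p volume =
      ENNReal.ofReal ((2 : ℝ) ^ (m * (-d + d * p⁻¹.toReal) : ℝ)) *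
        eLpNorm (𝓕⁻ (bumpS d) : 𝓢(Rd d, ℂ)) p volume := by
  have h2 : (0 : ℝ) < 2 ^ m := by positivity
  have hfun : (⇑(𝓕⁻ (dilatedBumpS d m) : 𝓢(Rd d, ℂ)) : Rd d → ℂ) = (((2 : ℝ) ^ m) ^ d)⁻¹ •
      fun x => (𝓕⁻ (bumpS d) : 𝓢(Rd d, ℂ)) (((2 : ℝ) ^ m)⁻¹ • x) :=
    funext fun x => fourierInv_dilatedBumpS m x
  rw [hfun, eLpNorm_const_smul, eLpNorm_comp_const_smul p
    (𝓕⁻ (bumpS d) : 𝓢(Rd d, ℂ)).continuous.aestronglyMeasurable (by positivity), ← ofReal_norm,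
    Real.norm_of_nonneg (by positivity), ← mul_assoc, ← ENNReal.ofReal_mul (by positivity)]
  congr 2
  rw [finrank_euclideanSpace_fin, Real.inv_rpow h2.le, ← Real.rpow_neg h2.le, neg_neg,
    ← Real.rpow_natCast (_ ^ m), ← Real.rpow_neg h2.le, ← Real.rpow_add h2, ← Real.rpow_natCast,
    ← Real.rpow_mul (by norm_num)]

theorem eLpNorm_dilatedBumpS (r : ℝ≥0∞) (m : ℕ) :
    eLpNorm (dilatedBumpS d m) r volume =
      ENNReal.ofReal ((2 : ℝ) ^ (m * -(d * r⁻¹.toReal) : ℝ)) * eLpNorm (bumpS d) r volume := by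
  have h := eLpNorm_comp_const_smul r (bumpS d).continuous.aestronglyMeasurable
    (by positivity : (0 : ℝ) < 2 ^ m)
  rw [finrank_euclideanSpace_fin, ← Real.rpow_natCast, ← Real.rpow_mul (by norm_num)] at h
  rw [← h]
  congr 1 with x
  rw [dilatedBumpS_apply, Real.rpow_natCast]

/-- The dilation test. -/
theorem EmbedsInFourierLebesgue.dilation_test {σ : Rd d → ℝ} (hσ : IsUnitCubeCutoff σ)
    {p q r : ℝ≥0∞} [Fact (1 ≤ p)] [Fact (1 ≤ q)] [Fact (1 ≤ r)] {μ : ℝ}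
    (h : EmbedsInFourierLebesgue σ p q r μ) :
    ∃ K : ℝ, ∀ n m : ℕ, n ≤ m →
      (2 : ℝ) ^ (m * (-(d * r⁻¹.toReal) + d - d * p⁻¹.toReal) + n * μ : ℝ) ≤ K := by
  obtain ⟨C, hC⟩ := h.test hσ
  set a := eLpNorm (bumpS d) r volume with ha
  have ha0 : a ≠ 0 := eLpNorm_bumpS_ne_zero Fact.out
  have hatop : a ≠ ∞ := ((bumpS d).memLp r volume).2.ne
  set b := eLpNorm (𝓕⁻ (bumpS d) : 𝓢(Rd d, ℂ)) p volume with hb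
  have hbtop : b ≠ ∞ := ((𝓕⁻ (bumpS d) : 𝓢(Rd d, ℂ)).memLp p volume).2.ne
  refine ⟨C * b.toReal / a.toReal, fun n m hnm => ?_⟩
  -- As `n ≤ m`, the support lies in the central part of the single cube at the origin.
  have h1 := hC n {0} (fun _ => dilatedBumpS d m)
    (eLpNorm (𝓕⁻ (dilatedBumpS d m) : 𝓢(Rd d, ℂ)) p volume)
    ((𝓕⁻ (dilatedBumpS d m) : 𝓢(Rd d, ℂ)).memLp p volume).2.ne (fun k hk ξ hξ i => by
      rw [Finset.mem_singleton.mp hk]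
      rw [dilatedBumpS_apply] at hξ
      have h3 := abs_lt_of_bumpS_ne_zero hξ i
      have h4 : (2 : ℝ) ^ n ≤ 2 ^ m := pow_le_pow_right₀ one_le_two hnm
      simp only [PiLp.smul_apply, smul_eq_mul, abs_mul, abs_of_pos
        (by positivity : (0 : ℝ) < 2 ^ m)] at h3
      simp only [Pi.zero_apply, Int.cast_zero, sub_zero, abs_mul,
        abs_of_pos (by positivity : (0 : ℝ) < 2 ^ n)]
      exact (mul_le_mul_of_nonneg_right h4 (abs_nonneg _)).trans_lt h3) (fun _ _ => le_rfl)
  rw [Finset.sum_singleton, eLpNorm_dilatedBumpS, eLpNorm_fourierInv_dilatedBumpS, ← ha, ← hb,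
    Finset.card_singleton, Nat.cast_one, ENNReal.one_rpow, one_mul] at h1
  have h2 := ENNReal.toReal_mono (by finiteness) h1
  simp only [ENNReal.toReal_mul] at h2
  rw [ENNReal.toReal_ofReal (by positivity), ENNReal.toReal_ofReal (by positivity),
    ENNReal.toReal_ofReal (by positivity), ENNReal.coe_toReal] at h2
  have hapos : 0 < a.toReal := ENNReal.toReal_pos ha0 hatop
  rw [le_div_iff₀ hapos]
  have hsplit : (2 : ℝ) ^ (m * (-(d * r⁻¹.toReal) + d - d * p⁻¹.toReal) + n * μ : ℝ) =
      (2 : ℝ) ^ (m * -(d * r⁻¹.toReal) : ℝ) *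
        ((2 : ℝ) ^ (-(n : ℝ) * μ) * (2 : ℝ) ^ (m * (-d + d * p⁻¹.toReal) : ℝ))⁻¹ := by
    rw [← Real.rpow_add two_pos, ← Real.rpow_neg two_pos.le, ← Real.rpow_add two_pos]
    ring_nf
  rw [hsplit, mul_right_comm, mul_inv_le_iff₀ (by positivity)]
  refine h2.trans (le_of_eq ?_)
  ring

/-- Taking `n = 0` removes `μ` and leaves a condition on `p` and `r`; taking `n = m` gives the
condition on `μ`. -/
theorem EmbedsInFourierLebesgue.dilation_conditions {σ : Rd d → ℝ} (hσ : IsUnitCubeCutoff σ)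
    {p q r : ℝ≥0∞} [Fact (1 ≤ p)] [Fact (1 ≤ q)] [Fact (1 ≤ r)] {μ : ℝ}
    (h : EmbedsInFourierLebesgue σ p q r μ) :
    d * (1 - p⁻¹.toReal) ≤ d * r⁻¹.toReal ∧ μ ≤ d * (r⁻¹.toReal - (1 - p⁻¹.toReal)) := by
  obtain ⟨K, hK⟩ := h.dilation_test hσ
  have h1 := nonpos_of_two_rpow_le (x := -(d * r⁻¹.toReal) + d - d * p⁻¹.toReal) (K := K)
    fun m => by simpa using hK 0 m (Nat.zero_le m)
  have h2 := nonpos_of_two_rpow_le (x := -(d * r⁻¹.toReal) + d - d * p⁻¹.toReal + μ) (K := K)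
    fun m => by
      have := hK m m le_rfl
      rwa [← mul_add] at this
  constructor <;> linarith

/-! ### Translated bumps -/

/-- The small bump translated to a lattice point. -/
def translatedBumpS (k : Fin d → ℤ) : 𝓢(Rd d, ℂ) :=
  SchwartzMap.compSubConstCLM ℂ (latticePoint k) (bumpS d)

theorem translatedBumpS_apply (k : Fin d → ℤ) (x : Rd d) :
    translatedBumpS k x = bumpS d (x - latticePoint k) := rfl

theorem abs_lt_of_translatedBumpS_ne_zero {k : Fin d → ℤ} {x : Rd d} (h : translatedBumpS k x ≠ 0)
    (i : Fin d) : |x i - k i| < 1 / 4 := by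
  rw [translatedBumpS_apply] at h
  simpa [latticePoint] using abs_lt_of_bumpS_ne_zero h i

theorem norm_fourierInv_translatedBumpS (k : Fin d → ℤ) (x : Rd d) :
    ‖𝓕⁻ (translatedBumpS k) x‖ = ‖𝓕⁻ (bumpS d) x‖ := by
  rw [SchwartzMap.fourierInv_coe, SchwartzMap.fourierInv_coe, Real.fourierInv_eq,
    Real.fourierInv_eq]
  have h := integral_sub_right_eq_self (μ := (volume : Measure (Rd d)))
    (fun v => Real.fourierChar (inner ℝ (v + latticePoint k) x) • bumpS d v) (latticePoint k)
  simp only [sub_add_cancel] at h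
  have h1 : ∫ v, Real.fourierChar (inner ℝ v x) • translatedBumpS k v =
      ∫ v, (Real.fourierChar (inner ℝ (latticePoint k) x) : ℂ) *
        (Real.fourierChar (inner ℝ v x) • bumpS d v) := by
    refine Eq.trans h ?_
    congr 1 with v
    rw [inner_add_left, add_comm, AddChar.map_add_eq_mul, mul_smul, Circle.smul_def, smul_eq_mul]
  rw [h1, integral_const_mul, norm_mul, Circle.norm_coe, one_mul]

theorem eLpNorm_fourierInv_translatedBumpS (p : ℝ≥0∞) (k : Fin d → ℤ) :
    eLpNorm (𝓕⁻ (translatedBumpS k) : 𝓢(Rd d, ℂ)) p volume =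
      eLpNorm (𝓕⁻ (bumpS d) : 𝓢(Rd d, ℂ)) p volume :=
  eLpNorm_congr_norm_ae (Eventually.of_forall (norm_fourierInv_translatedBumpS k))

/-- The supports are disjoint, so at most one term is nonzero at each point. -/
theorem enorm_sum_translatedBumpS_rpow {s : ℝ} (hs : 0 < s) (A : Finset (Fin d → ℤ)) (x : Rd d) :
    ‖(∑ k ∈ A, translatedBumpS k : 𝓢(Rd d, ℂ)) x‖ₑ ^ s =
      ∑ k ∈ A, ‖translatedBumpS k x‖ₑ ^ s := by
  rw [sum_apply]
  by_cases hex : ∃ k ∈ A, translatedBumpS k x ≠ 0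
  · obtain ⟨k, hk, hne⟩ := hex
    have hz : ∀ k' ∈ A, k' ≠ k → translatedBumpS k' x = 0 := by
      intro k' _ hkk
      by_contra hne'
      refine notMem_freqCube_of_near (n := 0) hkk (ξ := x)
        (fun i => by simpa using abs_lt_of_translatedBumpS_ne_zero hne i) fun i => ?_
      have := abs_lt_of_translatedBumpS_ne_zero hne' i
      simp only [CharP.cast_eq_zero, neg_zero, zpow_zero, one_mul]
      linarith
    rw [Finset.sum_eq_single k hz fun h => absurd hk h,
      Finset.sum_eq_single k (fun k' hk' hkk => by
        rw [hz k' hk' hkk, enorm_zero, ENNReal.zero_rpow_of_pos hs]) fun h => absurd hk h]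
  · push Not at hex
    rw [Finset.sum_eq_zero hex, enorm_zero, ENNReal.zero_rpow_of_pos hs]
    exact (Finset.sum_eq_zero fun k hk => by
      rw [hex k hk, enorm_zero, ENNReal.zero_rpow_of_pos hs]).symm

theorem eLpNorm_sum_translatedBumpS {r : ℝ≥0∞} (hr : 1 ≤ r) (hrt : r ≠ ∞)
    (A : Finset (Fin d → ℤ)) :
    eLpNorm (∑ k ∈ A, translatedBumpS k : 𝓢(Rd d, ℂ)) r volume =
      (A.card : ℝ≥0∞) ^ r⁻¹.toReal * eLpNorm (bumpS d) r volume := by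
  have hr0 : r ≠ 0 := (zero_lt_one.trans_le hr).ne'
  have hpos : 0 < r.toReal := ENNReal.toReal_pos hr0 hrt
  rw [eLpNorm_eq_lintegral_rpow_enorm_toReal hr0 hrt,
    eLpNorm_eq_lintegral_rpow_enorm_toReal hr0 hrt]
  simp_rw [enorm_sum_translatedBumpS_rpow hpos]
  rw [lintegral_finsetSum' _ fun k _ =>
    ((translatedBumpS k).continuous.aestronglyMeasurable.enorm.pow_const _)]
  have h1 : ∀ k ∈ A, ∫⁻ x, ‖translatedBumpS k x‖ₑ ^ r.toReal = ∫⁻ x, ‖bumpS d x‖ₑ ^ r.toReal :=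
    fun k _ => lintegral_sub_right_eq_self (μ := (volume : Measure (Rd d)))
      (fun x => ‖bumpS d x‖ₑ ^ r.toReal) (latticePoint k)
  rw [Finset.sum_congr rfl h1, Finset.sum_const, nsmul_eq_mul,
    ENNReal.mul_rpow_of_nonneg _ _ (by positivity), one_div, ENNReal.toReal_inv]

/-- At scale `1`, where `μ` plays no role, `N` translated bumps have `L^r` norm of order `N^{1/r}`,
while their modulation norm is at most of order `N^{1/q}`. -/
theorem EmbedsInFourierLebesgue.q_le_r {σ : Rd d → ℝ} (hσ : IsUnitCubeCutoff σ) (hd : d ≠ 0)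
    {p q r : ℝ≥0∞} [Fact (1 ≤ p)] [Fact (1 ≤ q)] [Fact (1 ≤ r)] {μ : ℝ}
    (h : EmbedsInFourierLebesgue σ p q r μ) : q ≤ r := by
  by_cases hrt : r = ∞
  · rw [hrt]; exact le_top
  have hr1 : 1 ≤ r := Fact.out
  have hq1 : 1 ≤ q := Fact.out
  obtain ⟨C, hC⟩ := h.test hσ
  set a := eLpNorm (bumpS d) r volume with ha
  have hatop : a ≠ ∞ := ((bumpS d).memLp r volume).2.ne
  have hapos : 0 < a.toReal := ENNReal.toReal_pos (eLpNorm_bumpS_ne_zero Fact.out) hatop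
  set b := eLpNorm (𝓕⁻ (bumpS d) : 𝓢(Rd d, ℂ)) p volume with hb
  have hbtop : b ≠ ∞ := ((𝓕⁻ (bumpS d) : 𝓢(Rd d, ℂ)).memLp p volume).2.ne
  -- Needed for `ℤ^d` to be infinite, so that arbitrarily large sets `A` exist.
  have : Nonempty (Fin d) := ⟨⟨0, Nat.pos_of_ne_zero hd⟩⟩
  have hexp : r⁻¹.toReal - q⁻¹.toReal ≤ 0 := by
    refine nonpos_of_two_rpow_le (K := C * b.toReal / a.toReal) fun m => ?_
    obtain ⟨A, hA⟩ := Infinite.exists_subset_card_eq (Fin d → ℤ) (2 ^ m)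
    have h1 := hC 0 A translatedBumpS b hbtop
      (fun k _ ξ hξ i => by simpa using abs_lt_of_translatedBumpS_ne_zero hξ i)
      (fun k _ => (eLpNorm_fourierInv_translatedBumpS p k).le)
    rw [eLpNorm_sum_translatedBumpS hr1 hrt, hA] at h1
    have hfin : ((2 ^ m : ℕ) : ℝ≥0∞) ^ q⁻¹.toReal ≠ ∞ :=
      ENNReal.rpow_ne_top_of_nonneg ENNReal.toReal_nonneg (by simp)
    have h2 := ENNReal.toReal_mono (ENNReal.mul_ne_top ENNReal.coe_ne_top
      (ENNReal.mul_ne_top ENNReal.ofReal_ne_top (ENNReal.mul_ne_top hfin hbtop))) h1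
    simp only [ENNReal.toReal_mul, CharP.cast_eq_zero, neg_zero, zero_mul, Real.rpow_zero,
      ENNReal.ofReal_one, one_mul, ENNReal.coe_toReal,
      ← ENNReal.toReal_rpow, ENNReal.toReal_natCast] at h2
    push_cast at h2
    rw [← Real.rpow_natCast, ← Real.rpow_mul two_pos.le, ← Real.rpow_mul two_pos.le] at h2
    rw [le_div_iff₀ hapos, mul_sub, Real.rpow_sub two_pos, div_mul_eq_mul_div,
      div_le_iff₀ (by positivity)]
    refine h2.trans (le_of_eq ?_)
    ring
  have h1 : r⁻¹.toReal ≤ q⁻¹.toReal := by linarith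
  rw [ENNReal.toReal_le_toReal (ENNReal.inv_ne_top.mpr (zero_lt_one.trans_le hr1).ne')
    (ENNReal.inv_ne_top.mpr (zero_lt_one.trans_le hq1).ne')] at h1
  exact ENNReal.inv_le_inv.mp h1

/-! ### Chirps -/

theorem contDiff_chirp (b : ℂ) :
    ContDiff ℝ (⊤ : ℕ∞) (fun x : Rd d => Complex.exp (-b * ((‖x‖ ^ 2 : ℝ) : ℂ))) := by
  have h1 : ContDiff ℝ (⊤ : ℕ∞) (fun x : Rd d => ((‖x‖ ^ 2 : ℝ) : ℂ)) :=
    Complex.ofRealCLM.contDiff.comp (contDiff_norm_sq ℝ)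
  exact (contDiff_const.mul h1).cexp

/-- The small bump times a complex Gaussian. -/
def chirp (d : ℕ) (b : ℂ) : 𝓢(Rd d, ℂ) :=
  HasCompactSupport.toSchwartzMap (hasCompactSupport_smallBump.mul_right
    (f' := fun x : Rd d => Complex.exp (-b * ((‖x‖ ^ 2 : ℝ) : ℂ))))
    (contDiff_smallBump.mul (contDiff_chirp b))

theorem chirp_apply (b : ℂ) (x : Rd d) :
    chirp d b x = bumpS d x * Complex.exp (-b * ((‖x‖ ^ 2 : ℝ) : ℂ)) := rfl

theorem norm_chirp (b : ℂ) (x : Rd d) :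
    ‖chirp d b x‖ = ‖bumpS d x‖ * Real.exp (-(b.re * ‖x‖ ^ 2)) := by
  rw [chirp_apply, norm_mul, Complex.norm_exp]
  congr 2
  rw [Complex.re_mul_ofReal]
  simp

theorem eLpNorm_chirp_congr (r : ℝ≥0∞) {b b' : ℂ} (h : b.re = b'.re) :
    eLpNorm (chirp d b) r volume = eLpNorm (chirp d b') r volume :=
  eLpNorm_congr_norm_ae (Eventually.of_forall fun x => by rw [norm_chirp, norm_chirp, h])

/-- Moving the transform onto the Gaussian writes the value as an integral of `𝓕⁻` of the bump
against Gaussian transforms, each of modulus at most `(π/|b|)^{d/2}` because `Re(1/b) ≥ 0`. -/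
theorem enorm_fourierInv_chirp_le {b : ℂ} (hb : 0 < b.re) (x : Rd d) :
    ‖𝓕⁻ (chirp d b) x‖ₑ ≤ ENNReal.ofReal ((Real.pi / ‖b‖) ^ (d / 2 : ℝ)) *
      eLpNorm (𝓕⁻ (bumpS d) : 𝓢(Rd d, ℂ)) 1 volume := by
  set G : Rd d → ℂ := fun v => Complex.exp (-b * ‖v‖ ^ 2 + 2 * Real.pi * Complex.I * inner ℝ x v)
    with hG
  have hGint : Integrable G := GaussianFourier.integrable_cexp_neg_mul_sq_norm_add hb _ x
  have h1 : 𝓕⁻ (chirp d b) x = ∫ v, bumpS d v * G v := by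
    rw [SchwartzMap.fourierInv_coe, Real.fourierInv_eq']
    congr 1 with v
    rw [chirp_apply, smul_eq_mul, hG]
    simp only
    rw [mul_left_comm, ← Complex.exp_add, real_inner_comm]
    congr 2
    push_cast
    ring
  have h2 := (isFourierPair_L1 hGint).integral_eq (𝓕⁻ (bumpS d))
  rw [FourierTransform.fourier_fourierInv_eq] at h2
  rw [h1, h2]
  refine (enorm_integral_le_lintegral_enorm _).trans ?_
  rw [eLpNorm_one_eq_lintegral_enorm, ← lintegral_const_mul' _ _ ENNReal.ofReal_ne_top]
  refine lintegral_mono fun w => ?_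
  rw [enorm_mul, mul_comm]
  gcongr
  have hF := fourier_gaussian_innerProductSpace' hb x w
  rw [hG, hF, ← ofReal_norm]
  refine ENNReal.ofReal_le_ofReal ?_
  rw [norm_mul, finrank_euclideanSpace_fin]
  have e1 : ‖((Real.pi : ℂ) / b) ^ ((d : ℂ) / 2)‖ = (Real.pi / ‖b‖) ^ (d / 2 : ℝ) := by
    have : ((d : ℂ) / 2) = ((d / 2 : ℝ) : ℂ) := by push_cast; rfl
    rw [this, Complex.norm_cpow_real, norm_div, Complex.norm_real,
      Real.norm_of_nonneg Real.pi_pos.le]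
  have e2 : ‖Complex.exp (-(Real.pi : ℂ) ^ 2 * ‖x - w‖ ^ 2 / b)‖ ≤ 1 := by
    rw [Complex.norm_exp, Real.exp_le_one_iff]
    have : (-(Real.pi : ℂ) ^ 2 * ‖x - w‖ ^ 2 / b) =
        ((-(Real.pi ^ 2 * ‖x - w‖ ^ 2) : ℝ) : ℂ) * b⁻¹ := by push_cast; ring
    rw [this, Complex.re_ofReal_mul, Complex.inv_re]
    have h3 : 0 ≤ b.re / Complex.normSq b := div_nonneg hb.le (Complex.normSq_nonneg b)
    have h4 : 0 ≤ Real.pi ^ 2 * ‖x - w‖ ^ 2 := by positivity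
    nlinarith
  rw [e1]
  exact mul_le_of_le_one_right (by positivity) e2

theorem eLpNorm_le_sup_rpow_mul {α : Type*} [MeasurableSpace α] {μ : Measure α} {p : ℝ≥0∞}
    (hp : 2 < p) {f : α → ℂ} {S : ℝ≥0∞} (hStop : S ≠ ∞) (hS : ∀ x, ‖f x‖ₑ ≤ S) :
    eLpNorm f p μ ≤ S ^ (1 - 2 * p⁻¹.toReal) * eLpNorm f 2 μ ^ (2 * p⁻¹.toReal) := by
  by_cases hpt : p = ∞
  · subst hpt
    simp only [ENNReal.inv_top, ENNReal.toReal_zero, mul_zero, sub_zero, ENNReal.rpow_one,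
      ENNReal.rpow_zero, mul_one, eLpNorm_exponent_top]
    exact eLpNormEssSup_le_of_ae_enorm_bound (Eventually.of_forall hS)
  have hp0 : p ≠ 0 := (zero_le.trans_lt hp).ne'
  have hp2 : 2 < p.toReal := by
    have := (ENNReal.toReal_lt_toReal (by norm_num) hpt).mpr hp
    simpa using this
  rw [eLpNorm_eq_lintegral_rpow_enorm_toReal hp0 hpt,
    eLpNorm_eq_lintegral_rpow_enorm_toReal (by norm_num) (by norm_num), ENNReal.toReal_inv]
  simp only [ENNReal.toReal_ofNat]
  have hpt : ∀ x, ‖f x‖ₑ ^ p.toReal ≤ S ^ (p.toReal - 2) * ‖f x‖ₑ ^ (2 : ℝ) := fun x => by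
    have : p.toReal = (p.toReal - 2) + 2 := by ring
    conv_lhs => rw [this, ENNReal.rpow_add_of_nonneg _ _ (by linarith) (by norm_num)]
    exact mul_le_mul' (ENNReal.rpow_le_rpow (hS x) (by linarith)) le_rfl
  calc (∫⁻ x, ‖f x‖ₑ ^ p.toReal ∂μ) ^ (1 / p.toReal)
      ≤ (∫⁻ x, S ^ (p.toReal - 2) * ‖f x‖ₑ ^ (2 : ℝ) ∂μ) ^ (1 / p.toReal) := by
        gcongr with x
        exact hpt x
    _ = _ := by
        rw [lintegral_const_mul' _ _ (ENNReal.rpow_ne_top_of_nonneg (by linarith) hStop),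
          ENNReal.mul_rpow_of_nonneg _ _ (by positivity), ← ENNReal.rpow_mul, ← ENNReal.rpow_mul]
        congr 2 <;> field_simp

theorem eLpNorm_two_fourierInv (ψ : 𝓢(Rd d, ℂ)) :
    eLpNorm (𝓕⁻ ψ : 𝓢(Rd d, ℂ)) 2 volume = eLpNorm ψ 2 volume := by
  have h := norm_fourier_toL2_eq (𝓕⁻ ψ)
  rw [FourierTransform.fourier_fourierInv_eq, norm_toLp, norm_toLp,
    ENNReal.toReal_eq_toReal_iff' (ψ.memLp 2 volume).2.ne
      ((𝓕⁻ ψ : 𝓢(Rd d, ℂ)).memLp 2 volume).2.ne] at h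
  exact h.symm

theorem tendsto_chirp_bound (hd : d ≠ 0) :
    Tendsto (fun N : ℕ => ENNReal.ofReal
      ((Real.pi / ‖(1 + N * Complex.I : ℂ)‖) ^ (d / 2 : ℝ))) atTop (𝓝 0) := by
  have hnorm : Tendsto (fun N : ℕ => ‖(1 + N * Complex.I : ℂ)‖) atTop atTop := by
    refine tendsto_atTop_mono (fun N => ?_) tendsto_natCast_atTop_atTop
    simpa using Complex.abs_im_le_norm (1 + N * Complex.I : ℂ)
  have hd' : (0 : ℝ) < d / 2 := by positivity
  have h := ((tendsto_const_nhds (x := Real.pi)).div_atTop hnorm).rpow_const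
    (p := (d / 2 : ℝ)) (Or.inr hd'.le)
  rw [Real.zero_rpow hd'.ne'] at h
  simpa using ENNReal.tendsto_ofReal h

/-- For `b = 1 + iN` the modulus of the chirp is independent of `N`, hence so are its `L^r` norm
and, by Plancherel, the `L²` norm of its inverse transform, whose supremum tends to `0`. If `p > 2`,
interpolating between `L²` and `L^∞` sends the `L^p` norm to `0`, contradicting the embedding. -/
theorem EmbedsInFourierLebesgue.p_le_two {σ : Rd d → ℝ} (hσ : IsUnitCubeCutoff σ) (hd : d ≠ 0)
    {p q r : ℝ≥0∞} [Fact (1 ≤ p)] [Fact (1 ≤ q)] [Fact (1 ≤ r)] {μ : ℝ}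
    (h : EmbedsInFourierLebesgue σ p q r μ) : p ≤ 2 := by
  by_contra! hp
  obtain ⟨C, hC⟩ := h.test hσ
  have hr : (1 : ℝ≥0∞) ≤ r := Fact.out
  set b : ℕ → ℂ := fun N => 1 + N * Complex.I with hb
  have hre : ∀ N, (b N).re = (1 : ℂ).re := fun N => by simp [hb]
  have ha : eLpNorm (chirp d 1) r volume ≠ 0 :=
    eLpNorm_ne_zero_of_apply_zero (chirp d 1).continuous (by simp [chirp_apply, bumpS_zero])
      (zero_lt_one.trans_le hr).ne'
  set K := eLpNorm (𝓕⁻ (bumpS d) : 𝓢(Rd d, ℂ)) 1 volume with hK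
  have hKtop : K ≠ ∞ := ((𝓕⁻ (bumpS d) : 𝓢(Rd d, ℂ)).memLp 1 volume).2.ne
  set S : ℕ → ℝ≥0∞ := fun N => ENNReal.ofReal ((Real.pi / ‖b N‖) ^ (d / 2 : ℝ)) * K with hS
  have hS0 : Tendsto S atTop (𝓝 0) := by
    simpa using ENNReal.Tendsto.mul_const (tendsto_chirp_bound hd) (Or.inr hKtop)
  set L := eLpNorm (chirp d 1) 2 volume ^ (2 * p⁻¹.toReal) with hL
  have hLtop : L ≠ ∞ :=
    ENNReal.rpow_ne_top_of_nonneg (by positivity) ((chirp d 1).memLp 2 volume).2.ne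
  have hexp : 0 < 1 - 2 * p⁻¹.toReal := by
    have h1 : p⁻¹ < 2⁻¹ := ENNReal.inv_lt_inv.mpr hp
    have h2 := (ENNReal.toReal_lt_toReal h1.ne_top (by simp)).mpr h1
    simp only [ENNReal.toReal_inv, ENNReal.toReal_ofNat] at h2 ⊢
    linarith
  have hbound : ∀ N, eLpNorm (chirp d 1) r volume ≤ C * (S N ^ (1 - 2 * p⁻¹.toReal) * L) := by
    intro N
    have h1 := hC 0 {0} (fun _ => chirp d (b N))
      (eLpNorm (𝓕⁻ (chirp d (b N)) : 𝓢(Rd d, ℂ)) p volume)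
      ((𝓕⁻ (chirp d (b N)) : 𝓢(Rd d, ℂ)).memLp p volume).2.ne
      (fun k hk ξ hξ i => by
        have h2 := abs_lt_of_bumpS_ne_zero (left_ne_zero_of_mul (chirp_apply (b N) ξ ▸ hξ)) i
        simpa [Finset.mem_singleton.mp hk] using h2) (fun _ _ => le_rfl)
    simp only [Finset.sum_singleton, Finset.card_singleton, CharP.cast_eq_zero, neg_zero, zero_mul,
      Real.rpow_zero, ENNReal.ofReal_one, Nat.cast_one, ENNReal.one_rpow, one_mul] at h1
    rw [← eLpNorm_chirp_congr r (hre N)]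
    refine h1.trans (mul_le_mul' le_rfl ?_)
    rw [hL, ← eLpNorm_chirp_congr 2 (hre N), ← eLpNorm_two_fourierInv]
    exact eLpNorm_le_sup_rpow_mul hp (ENNReal.mul_ne_top ENNReal.ofReal_ne_top hKtop)
      (enorm_fourierInv_chirp_le (by rw [hre]; simp))
  have hlim : Tendsto (fun N => C * (S N ^ (1 - 2 * p⁻¹.toReal) * L)) atTop (𝓝 0) := by
    have h1 := (ENNReal.continuous_rpow_const (y := 1 - 2 * p⁻¹.toReal)).tendsto 0 |>.comp hS0
    rw [ENNReal.zero_rpow_of_pos hexp] at h1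
    simpa using ENNReal.Tendsto.const_mul (ENNReal.Tendsto.mul_const h1 (Or.inr hLtop))
      (Or.inr (ENNReal.coe_ne_top (r := C)))
  exact ha (le_antisymm (ge_of_tendsto' hlim hbound) zero_le)

end ScalingLimitModulation
end

theorem proposition3p2 (d : ℕ) (σ : ScalingLimitModulation.Rd d → ℝ)
    (hσ : ScalingLimitModulation.IsUnitCubeCutoff σ)
    (p q r : ℝ≥0∞) [Fact (1 ≤ p)] [Fact (1 ≤ q)] [Fact (1 ≤ r)] (μ : ℝ)
    (hμ₁ : ScalingLimitModulation.indexSigma d p q ≤ μ)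
    (hμ₂ : μ ≤ ScalingLimitModulation.indexA d p q)
    (hlt : ScalingLimitModulation.indexSigma d p q < ScalingLimitModulation.indexA d p q) :
    ScalingLimitModulation.EmbedsInFourierLebesgue σ p q r μ ↔
      p ≤ 2 ∧ q ≤ r ∧ r ≤ p.conjExponent ∧
        μ - d * p⁻¹.toReal ≤ -(d * (r.conjExponent)⁻¹.toReal) := by
  -- In dimension `0` both indices vanish, against the strict inequality `hlt`.
  have hd : d ≠ 0 := by
    rintro rfl
    simp [ScalingLimitModulation.indexSigma, ScalingLimitModulation.indexA] at hlt
  have hp : 1 ≤ p := Fact.out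
  have hr : 1 ≤ r := Fact.out
  have hp' := ScalingLimitModulation.toReal_inv_conjExponent hp
  have hr' := ScalingLimitModulation.toReal_inv_conjExponent hr
  constructor
  · intro h
    obtain ⟨h1, h2⟩ := h.dilation_conditions hσ
    refine ⟨h.p_le_two hσ hd, h.q_le_r hσ hd, ?_, ?_⟩
    · have h3 : p.conjExponent⁻¹.toReal ≤ r⁻¹.toReal := by
        rw [hp']
        exact le_of_mul_le_mul_left h1 (by positivity)
      have hpc : p.conjExponent ≠ 0 := by
        rw [ENNReal.conjExponent]
        exact (zero_lt_one.trans_le le_self_add).ne'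
      rw [ENNReal.toReal_le_toReal (ENNReal.inv_ne_top.mpr hpc)
        (ENNReal.inv_ne_top.mpr (zero_lt_one.trans_le hr).ne')] at h3
      exact ENNReal.inv_le_inv.mp h3
    · rw [hr']
      linarith
  · rintro ⟨hp2, hqr, hrp, h⟩
    refine ScalingLimitModulation.embedsInFourierLebesgue_of_le hσ hp2 hqr hrp ?_
    rw [hr'] at h
    rw [hp']
    linarith
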